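/- Let $\alpha\in(0,1)$ (the damping factor). For a finite directed graph $G$ with $n$ nodes (self-loops allowed, no multiple arcs) let $M$ be the $n\times n$ matrix with $M_{ij}=1/n$ if node $i$ has no children, and otherwise $M_{ij}=1/m$ or $0$ according to whether $j$ is or is not one of the $m>0$ children of $i$. The PageRank vector $P$ is the unique solution of $P=\alpha PM+(1-\alpha)\,(1/n,\dots,1/n)$. A randomized algorithm receives the identifier of a target node $v$ (identifiers are arbitrary distinct natural numbers) and no other information on $G$; in particular it is not told $n$. It may use internal randomness, its internal computation is free, and it explores $G$ through two kinds of queries: $RandomNode()$, which returns an independent uniformly random node of $G$, and $Neighbourhood(u)$, which returns the set of all parents and the set of all children of $u$, where $u$ must be $v$ or a node returned by an earlier query. **Theorem.** For every $\alpha\in(0,1)$ and $\varepsilon_0\in(0,1)$ there is a constant $C>0$ such that for every $\varepsilon\in(0,\varepsilon_0]$ there is a randomized algorithm with the following property: for every directed graph $G$ with any number $n\ge 2$ of nodes, every assignment of identifiers and every node $v$ of $G$, with probability at least $1-\varepsilon$ the algorithm stops after at most $$C\cdot\frac1\varepsilon\sqrt{\log\frac1\varepsilon}\cdot n^{2/3}(\log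 n)^{1/3}$$ queries and returns a number $x$ with $(1-\varepsilon)P(v)\le x\le(1+\varepsilon)P(v)$. -/

import Mathlib

open scoped ENNReal

noncomputable section

namespace LocalPageRank

/-! ### PageRank of a finite directed graph (self-loops allowed, no multiple arcs) -/

open Classical in
/-- The set of children (out-neighbours) of `u`. -/
def children {V : Type*} [Fintype V] (G : Digraph V) (u : V) : Finset V :=
  Finset.univ.filter fun w => G.Adj u w

open Classical in
/-- The set of parents (in-neighbours) of `u`. -/
def parents {V : Type*} [Fintype V] (G : Digraph V) (u : V) : Finset V :=
  Finset.univ.filter fun w => G.Adj w u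

open Classical in
/-- The transition matrix of the surfer: the row of a dangling (childless) node is uniform over
all the nodes, the row of any other node is uniform over its children. -/
def transition {V : Type*} [Fintype V] (G : Digraph V) : Matrix V V ℝ := fun i j =>
  if children G i = ∅ then (Fintype.card V : ℝ)⁻¹
  else if j ∈ children G i then ((children G i).card : ℝ)⁻¹ else 0

open Classical in
/-- The PageRank vector with damping factor `α`: the solution
`P = (1-α) n⁻¹ 𝟙 (1 - α M)⁻¹` of `P = α P M + (1-α) n⁻¹ 𝟙`;
see `eq_pageRank_iff` for existence and uniqueness of the solution. -/
def pageRank {V : Type*} [Fintype V] (α : ℝ) (G : Digraph V) : V → ℝ :=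
  Matrix.vecMul (fun _ => (1 - α) * (Fintype.card V : ℝ)⁻¹) (1 - α • transition G)⁻¹

theorem transition_nonneg {V : Type*} [Fintype V] (G : Digraph V) (i j : V) :
    0 ≤ transition G i j := by
  unfold transition
  split_ifs <;> positivity

theorem transition_row_sum {V : Type*} [Fintype V] (G : Digraph V) (i : V) :
    ∑ j, transition G i j = 1 := by
  have hV : (Fintype.card V : ℝ) ≠ 0 := by
    have : Nonempty V := ⟨i⟩
    exact_mod_cast Fintype.card_ne_zero
  unfold transition
  by_cases h : children G i = ∅
  · simp [h, hV]
  · have h' : ((children G i).card : ℝ) ≠ 0 := by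
      simpa using h
    simp [h, h']

open Classical in
theorem det_ne_zero {V : Type*} [Fintype V] {α : ℝ} (h0 : 0 < α) (h1 : α < 1) (G : Digraph V) :
    (1 - α • transition G : Matrix V V ℝ).det ≠ 0 := by
  refine det_ne_zero_of_sum_row_lt_diag fun k => ?_
  have hs := transition_row_sum G k
  rw [← Finset.add_sum_erase _ _ (Finset.mem_univ k)] at hs
  have e : ∑ j ∈ Finset.univ.erase k, ‖(1 - α • transition G : Matrix V V ℝ) k j‖
      = α * ∑ j ∈ Finset.univ.erase k, transition G k j := by
    rw [Finset.mul_sum]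
    refine Finset.sum_congr rfl fun j hj => ?_
    have hjk : k ≠ j := fun h => (Finset.mem_erase.1 hj).1 h.symm
    simp [Matrix.one_apply_ne hjk, abs_of_pos h0, abs_of_nonneg (transition_nonneg G k j)]
  rw [e]
  have h2 := transition_nonneg G k k
  refine lt_of_lt_of_le ?_ (Real.le_norm_self _)
  simp only [Matrix.sub_apply, Matrix.one_apply_eq, Matrix.smul_apply, smul_eq_mul]
  nlinarith

/-- The PageRank vector is the unique solution of `P = α P M + (1-α) n⁻¹ 𝟙`. -/
theorem eq_pageRank_iff {V : Type*} [Fintype V] {α : ℝ} (h0 : 0 < α) (h1 : α < 1)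
    (G : Digraph V) (P : V → ℝ) :
    P = pageRank α G ↔
      ∀ j, P j = α * ∑ i, P i * transition G i j + (1 - α) * (Fintype.card V : ℝ)⁻¹ := by
  classical
  have hu : IsUnit (1 - α • transition G : Matrix V V ℝ).det :=
    isUnit_iff_ne_zero.2 (det_ne_zero h0 h1 G)
  have key : (∀ j, P j = α * ∑ i, P i * transition G i j + (1 - α) * (Fintype.card V : ℝ)⁻¹) ↔
      Matrix.vecMul P (1 - α • transition G) =
        fun _ => (1 - α) * (Fintype.card V : ℝ)⁻¹ := by
    rw [Matrix.vecMul_sub, Matrix.vecMul_one, Matrix.vecMul_smul, funext_iff]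
    refine forall_congr' fun j => ?_
    simp only [Pi.sub_apply, Pi.smul_apply, smul_eq_mul, Matrix.vecMul, dotProduct]
    constructor <;> intro h <;> linarith
  rw [key]
  unfold pageRank
  constructor
  · intro h
    rw [h, Matrix.vecMul_vecMul]
    rw [Matrix.nonsing_inv_mul _ hu, Matrix.vecMul_one]
  · intro h
    rw [← h, Matrix.vecMul_vecMul]
    rw [Matrix.mul_nonsing_inv _ hu, Matrix.vecMul_one]

/-! ### Randomized exploration algorithms and their query-bounded runs

Nodes are presented to an algorithm through identifiers, which are arbitrary distinct natural
numbers; the algorithm is not told the number of nodes. -/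

/-- What an algorithm with internal states in `S` may do next: stop with an estimate, or make a
query and continue in a state that depends on the answer. -/
inductive Action (S : Type)
  /-- Stop and return `x`. -/
  | output (x : ℝ) : Action S
  /-- Query `RandomNode()`; `next w` is the new state when the answer is the node `w`. -/
  | randomNode (next : ℕ → S) : Action S
  /-- Query `Neighbourhood(u)`; `next A B` is the new state when the parents of `u` are `A` and
  its children are `B`. -/
  | neighbourhood (u : ℕ) (next : Finset ℕ → Finset ℕ → S) : Action S

/-- A randomized algorithm. Its internal computation is free and may use internal randomness:
in each state the next action is drawn from a distribution. -/
structure Algorithm where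
  /-- The internal states. -/
  State : Type
  /-- The initial state, given the identifier of the target node. -/
  init : ℕ → State
  /-- The distribution of the next action. -/
  step : State → PMF (Action State)

open Classical in
/-- Identifiers of the parents of the node with identifier `u`. -/
def parentIds {V : Type*} [Fintype V] (G : Digraph V) (ident : V ↪ ℕ) (u : ℕ) : Finset ℕ :=
  Finset.univ.biUnion fun x : V => if ident x = u then (parents G x).map ident else ∅

open Classical in
/-- Identifiers of the children of the node with identifier `u`. -/
def childIds {V : Type*} [Fintype V] (G : Digraph V) (ident : V ↪ ℕ) (u : ℕ) : Finset ℕ :=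
  Finset.univ.biUnion fun x : V => if ident x = u then (children G x).map ident else ∅

/-- Distribution of the result of running `A` from state `s` on `G` with at most `b` queries, where
`K` is the set of already known nodes. The result is `some x` if `A` stops with the output `x`
having made at most `b` queries, and `none` if it attempts a further query. `RandomNode()`
is answered by a fresh uniformly random node. Only already known nodes may be given as input to
`Neighbourhood`; a run that violates this fails (result `none`). -/
def run {V : Type*} [Fintype V] [Nonempty V] (G : Digraph V) (ident : V ↪ ℕ) (A : Algorithm) :
    ℕ → A.State → Finset ℕ → PMF (Option ℝ)
  | 0, s, _ => (A.step s).bind fun a =>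
      match a with
      | .output x => PMF.pure (some x)
      | .randomNode _ => PMF.pure none
      | .neighbourhood _ _ => PMF.pure none
  | b + 1, s, K => (A.step s).bind fun a =>
      match a with
      | .output x => PMF.pure (some x)
      | .randomNode next => (PMF.uniformOfFintype V).bind fun w =>
          run G ident A b (next (ident w)) (insert (ident w) K)
      | .neighbourhood u next =>
          if u ∈ K then
            run G ident A b (next (parentIds G ident u) (childIds G ident u))
              (K ∪ parentIds G ident u ∪ childIds G ident u)
          else PMF.pure none

/-- The probability that `A`, started on the target node `v` of `G`, stops after at most `b` queries
with an output within a factor `1 ± ε` of the PageRank score of `v`. -/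
def successProb {V : Type*} [Fintype V] [Nonempty V] (α ε : ℝ) (G : Digraph V) (ident : V ↪ ℕ)
    (A : Algorithm) (b : ℕ) (v : V) : ℝ≥0∞ :=
  (run G ident A b (A.init (ident v)) {ident v}).toOuterMeasure
    {o | ∃ x : ℝ, o = some x ∧
      (1 - ε) * pageRank α G v ≤ x ∧ x ≤ (1 + ε) * pageRank α G v}

/-- The rate `(1/ε) √(log (1/ε)) · n^(2/3) (log n)^(1/3)`. -/
def rate (ε : ℝ) (n : ℕ) : ℝ :=
  1 / ε * Real.sqrt (Real.log (1 / ε)) * ((n : ℝ) ^ (2 / 3 : ℝ) * Real.log n ^ (1 / 3 : ℝ))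

end LocalPageRank

end

open scoped ENNReal

noncomputable section

namespace LocalPageRank

/-! The idea is to write `P(v)` as the PageRank-mean of a function with a small maximum and to
average that function along a trajectory of the random surfer. A core `Q` is a set of nodes
containing `v`; its weight `e u` is the damped expected number of visits at `v` of walks from `u`
that follow arcs inside `Q`. Pairing the PageRank equation with `e` shows that `P(v)` is the mean of
the residual outside `Q` (one damped step into the core, weighted by `e`) plus `avg e` times the
chance of a uniform jump: `sum_pageRank_mul_coreEstimate`. If all residuals outside `Q` are at most
`θ`, the solution of the Poisson equation is at most `H = (θ + P(v)/(1-α))/(1-α)`, and the sum over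
`m` surfer steps has mean square error of order `H P(v) m + H²`, with no appeal to mixing times
(`surfExp_sq_le`). Chebyshev then asks for `ε³ m` to be a large multiple of `H / P(v)`.

A good core is found greedily. A new node has weight at least its residual, weights only grow with
the core, and they sum to at most `n P(v)/(1-α)` (`avg_coreWeight_le`), so `m` additions cannot all
have large residuals (`wp_explore`, `card_mul_le`). The residual of a node not yet queried requires
its number of children. This is underestimated by the number of children found in a sample of `m`
random nodes; with high probability the loss is a factor of at most `2D`, with `D` about `n log n /
m` (`drawExp_degree`). Hence `θ` is about `D n P(v) / m`, so `H / P(v)` is about `n² log n / m²`,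
and balancing against `ε³ m` gives `m³ ≈ n² log n / ε³`, the choice `scale`.

The number `n` enters through the choice of `m` and through `avg e`. Both times it is estimated from
collisions among random nodes, whose number has variance at most its mean
(`drawExp_collisions_variance`).

The balance fails when `ε³ * scale` is below 1. Then `n` is so small compared with `1/ε` that
collecting all the nodes, at cost `n log (n/ε)`, is affordable; this case is the source of the
factor `√(log (1/ε))`. The failure probability `ε` is split into quarters: search for `n`, degrees,
collisions, surfer. -/

/-! ### Randomized exploration programs -/

/-- Terminating randomized exploration programs returning a value in `R`. -/
inductive Prog (R : Type) : Type
  /-- Return a value. -/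
  | ret (a : R) : Prog R
  /-- Query `RandomNode()`. -/
  | rand (k : ℕ → Prog R) : Prog R
  /-- Query `Neighbourhood(u)`. -/
  | nbr (u : ℕ) (k : Finset ℕ → Finset ℕ → Prog R) : Prog R
  /-- Toss a coin of bias `p`. -/
  | coin (p : NNReal) (hp : p ≤ 1) (k : Bool → Prog R) : Prog R
  /-- Pick a uniformly random element of a finite set. -/
  | pick (S : Finset ℕ) (hS : S.Nonempty) (k : ℕ → Prog R) : Prog R

namespace Prog

variable {R R' : Type}

/-- Sequential composition. -/
def bind : Prog R → (R → Prog R') → Prog R'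
  | ret a, f => f a
  | rand k, f => rand fun w => (k w).bind f
  | nbr u k, f => nbr u fun A B => (k A B).bind f
  | coin p hp k, f => coin p hp fun i => (k i).bind f
  | pick S hS k, f => pick S hS fun i => (k i).bind f

/-- The distribution of a coin of bias `p`. -/
def coinPMF (p : NNReal) (hp : p ≤ 1) : PMF Bool :=
  PMF.ofFintype (fun i => if i then p else 1 - p) (by
    rw [Fintype.sum_bool]
    simpa using add_tsub_cancel_of_le (by exact_mod_cast hp : (p : ℝ≥0∞) ≤ 1))

/-- The next action of a program. -/
def action {X : Type} : Prog ℝ → PMF (Action (X ⊕ Prog ℝ))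
  | ret x => PMF.pure (.output x)
  | rand k => PMF.pure (.randomNode fun w => .inr (k w))
  | nbr u k => PMF.pure (.neighbourhood u fun A B => .inr (k A B))
  | coin p hp k => (coinPMF p hp).bind fun i => (k i).action
  | pick S hS k => (PMF.uniformOfFinset S hS).bind fun i => (k i).action

end Prog

/-- The average of a function on a finite type. -/
def avg {V : Type*} [Fintype V] (g : V → ℝ) : ℝ := (Fintype.card V : ℝ)⁻¹ * ∑ w, g w

section avg
variable {V : Type*} [Fintype V]

theorem avg_mono {f g : V → ℝ} (h : ∀ w, f w ≤ g w) : avg f ≤ avg g :=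
  mul_le_mul_of_nonneg_left (Finset.sum_le_sum fun w _ => h w) (by positivity)

theorem avg_add (f g : V → ℝ) : avg (fun w => f w + g w) = avg f + avg g := by
  simp [avg, Finset.sum_add_distrib, mul_add]

theorem avg_mul_left (c : ℝ) (f : V → ℝ) : avg (fun w => c * f w) = c * avg f := by
  simp only [avg, ← Finset.mul_sum]; ring

theorem avg_const [Nonempty V] (c : ℝ) : avg (fun _ : V => c) = c := by
  have : (Fintype.card V : ℝ) ≠ 0 := by exact_mod_cast Fintype.card_ne_zero
  simp [avg, this]

theorem avg_nonneg {f : V → ℝ} (h : ∀ w, 0 ≤ f w) : 0 ≤ avg f :=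
  mul_nonneg (by positivity) (Finset.sum_nonneg fun w _ => h w)

end avg

/-! ### Expectations of programs and guarantees valid on every run. -/

section semantics
variable {V : Type*} [Fintype V] (G : Digraph V) (ident : V ↪ ℕ) {R R' : Type}

/-- Expectation of `φ` of the value returned by a program run on `G`. -/
def expect : Prog R → (R → ℝ) → ℝ
  | .ret a, φ => φ a
  | .rand k, φ => avg fun w : V => expect (k (ident w)) φ
  | .nbr u k, φ => expect (k (parentIds G ident u) (childIds G ident u)) φ
  | .coin p _ k, φ => p * expect (k true) φ + (1 - p) * expect (k false) φ
  | .pick S _ k, φ => (S.card : ℝ)⁻¹ * ∑ i ∈ S, expect (k i) φ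

/-- `wp p Q b K`: started with `b` queries left and the set `K` of known nodes, `p` makes only
legal queries, at most `b` of them, and satisfies `Q` of the number of queries left, the set of
known nodes and the returned value at its end. -/
def wp : Prog R → (ℕ → Finset ℕ → R → Prop) → ℕ → Finset ℕ → Prop
  | .ret a, Q, b, K => Q b K a
  | .rand k, Q, b, K => 1 ≤ b ∧ ∀ w : V, wp (k (ident w)) Q (b - 1) (insert (ident w) K)
  | .nbr u k, Q, b, K => u ∈ K ∧ 1 ≤ b ∧
      wp (k (parentIds G ident u) (childIds G ident u)) Q (b - 1)
        (K ∪ parentIds G ident u ∪ childIds G ident u)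
  | .coin _ _ k, Q, b, K => ∀ i, wp (k i) Q b K
  | .pick S _ k, Q, b, K => ∀ i ∈ S, wp (k i) Q b K

variable {G ident}

theorem expect_bind (p : Prog R) (f : R → Prog R') (φ : R' → ℝ) :
    expect G ident (p.bind f) φ = expect G ident p fun a => expect G ident (f a) φ := by
  induction p with
  | ret a => rfl
  | rand k ih => simp only [Prog.bind, expect, ih]
  | nbr u k ih => simp only [Prog.bind, expect, ih]
  | coin p hp k ih => simp only [Prog.bind, expect, ih]
  | pick S hS k ih => simp only [Prog.bind, expect, ih]

theorem wp_mono {p : Prog R} {Q Q' : ℕ → Finset ℕ → R → Prop} {b : ℕ} {K : Finset ℕ}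
    (h : wp G ident p Q b K) (hQ : ∀ b K a, Q b K a → Q' b K a) : wp G ident p Q' b K := by
  induction p generalizing b K with
  | ret a => exact hQ _ _ _ h
  | rand k ih => exact ⟨h.1, fun w => ih _ (h.2 w)⟩
  | nbr u k ih => exact ⟨h.1, h.2.1, ih _ _ h.2.2⟩
  | coin p hp k ih => exact fun i => ih _ (h i)
  | pick S hS k ih => exact fun i hi => ih _ (h i hi)

theorem wp_bind {p : Prog R} {f : R → Prog R'} {Q : ℕ → Finset ℕ → R' → Prop} {b : ℕ}
    {K : Finset ℕ} (h : wp G ident p (fun b' K' a => wp G ident (f a) Q b' K') b K) :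
    wp G ident (p.bind f) Q b K := by
  induction p generalizing b K with
  | ret a => exact h
  | rand k ih => exact ⟨h.1, fun w => ih _ (h.2 w)⟩
  | nbr u k ih => exact ⟨h.1, h.2.1, ih _ _ h.2.2⟩
  | coin p hp k ih => exact fun i => ih _ (h i)
  | pick S hS k ih => exact fun i hi => ih _ (h i hi)

/-- This makes `wp` a source of invariants: expectations ignore budgets and known nodes, so any
convenient `b` and `K` will do in an application. -/
theorem expect_le_of_wp {p : Prog R} {Q : ℕ → Finset ℕ → R → Prop} {b : ℕ} {K : Finset ℕ}
    (h : wp G ident p Q b K) {φ ψ : R → ℝ} (hφ : ∀ b K a, Q b K a → φ a ≤ ψ a) :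
    expect G ident p φ ≤ expect G ident p ψ := by
  induction p generalizing b K with
  | ret a => exact hφ _ _ _ h
  | rand k ih => exact avg_mono fun w => ih _ (h.2 w)
  | nbr u k ih => exact ih _ _ h.2.2
  | coin p hp k ih =>
    have hp' : (0 : ℝ) ≤ 1 - p := sub_nonneg.2 (by exact_mod_cast hp)
    exact add_le_add (mul_le_mul_of_nonneg_left (ih _ (h _)) p.coe_nonneg)
      (mul_le_mul_of_nonneg_left (ih _ (h _)) hp')
  | pick S hS k ih =>
    exact mul_le_mul_of_nonneg_left (Finset.sum_le_sum fun i hi => ih _ (h i hi)) (by positivity)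

theorem expect_const [Nonempty V] (p : Prog R) (c : ℝ) : expect G ident p (fun _ => c) = c := by
  induction p with
  | ret a => rfl
  | rand k ih => simp only [expect, ih, avg_const]
  | nbr u k ih => simp only [expect, ih]
  | coin p hp k ih => simp only [expect, ih]; ring
  | pick S hS k ih =>
    have : (S.card : ℝ) ≠ 0 := by exact_mod_cast hS.card_ne_zero
    simp [expect, ih, this]

theorem expect_add (p : Prog R) (φ ψ : R → ℝ) :
    expect G ident p (fun a => φ a + ψ a) = expect G ident p φ + expect G ident p ψ := by
  induction p with
  | ret a => rfl
  | rand k ih => simp only [expect, ih, avg_add]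
  | nbr u k ih => simp only [expect, ih]
  | coin p hp k ih => simp only [expect, ih]; ring
  | pick S hS k ih => simp only [expect, ih, Finset.sum_add_distrib, mul_add]

theorem expect_nonneg {p : Prog R} {φ : R → ℝ} (hφ : ∀ a, 0 ≤ φ a) :
    0 ≤ expect G ident p φ := by
  induction p with
  | ret a => exact hφ _
  | rand k ih => exact avg_nonneg fun w => ih _
  | nbr u k ih => exact ih _ _
  | coin p hp k ih =>
    have hp' : (0 : ℝ) ≤ 1 - p := sub_nonneg.2 (by exact_mod_cast hp)
    exact add_nonneg (mul_nonneg p.coe_nonneg (ih _)) (mul_nonneg hp' (ih _))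
  | pick S hS k ih => exact mul_nonneg (by positivity) (Finset.sum_nonneg fun i _ => ih _)

end semantics

/-! ### Searching for the number of nodes -/

/-- The number of pairs of equal entries of a list. -/
def collisions {X : Type*} [DecidableEq X] : List X → ℕ
  | [] => 0
  | w :: l => l.count w + collisions l

theorem collisions_map {V : Type*} [DecidableEq V] (ident : V ↪ ℕ) (l : List V) :
    collisions (l.map ident) = collisions l := by
  induction l with
  | nil => rfl
  | cons w l ih => simp [collisions, ih, List.count_map_of_injective _ _ ident.injective]

/-- The transitions of `birthdaySearch`. -/
def birthdayStep (k : ℕ) (main : ℕ → ℕ → Prog ℝ) :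
    (ℕ × List ℕ) ⊕ Prog ℝ → PMF (Action ((ℕ × List ℕ) ⊕ Prog ℝ))
  | .inl (v, l) =>
      if k ≤ collisions l then (main v l.length).action
      else PMF.pure (.randomNode fun w => .inl (v, w :: l))
  | .inr p => p.action

/-- Sample random nodes until `k` collisions have been seen, then continue with the program
`main v q`, where `v` is the target node and `q` the number of samples. -/
def birthdaySearch (k : ℕ) (main : ℕ → ℕ → Prog ℝ) : Algorithm where
  State := (ℕ × List ℕ) ⊕ Prog ℝ
  init v := .inl (v, [])
  step := birthdayStep k main

/-- Value of `birthdaySearch` cut off after `F` samples, if the continuation after `q` samples has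
value `ψ q`. -/
def birthdayValue {V : Type*} [Fintype V] [DecidableEq V] (k : ℕ) (ψ : ℕ → ℝ) : ℕ → List V → ℝ
  | 0, l => if k ≤ collisions l then ψ l.length else 0
  | F + 1, l => if k ≤ collisions l then ψ l.length else
      avg fun w => birthdayValue k ψ F (w :: l)

theorem birthdayValue_nonneg {V : Type*} [Fintype V] [DecidableEq V] {k : ℕ} {ψ : ℕ → ℝ} (hψ : ∀ q, 0 ≤ ψ q) (F : ℕ)
    (l : List V) : 0 ≤ birthdayValue k ψ F l := by
  induction F generalizing l with
  | zero => unfold birthdayValue; split_ifs <;> simp [hψ]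
  | succ F ih =>
    unfold birthdayValue
    split_ifs
    · exact hψ _
    · exact avg_nonneg fun w => ih _

/-! ### From programs to runs of the algorithm. -/

section run
variable {V : Type*} [Fintype V] [Nonempty V] {G : Digraph V} {ident : V ↪ ℕ}

open Classical in
theorem avg_ofReal (g : V → ℝ) (hg : ∀ w, 0 ≤ g w) :
    ENNReal.ofReal (avg g) = ∑' w, PMF.uniformOfFintype V w * ENNReal.ofReal (g w) := by
  have hV : (0 : ℝ) < Fintype.card V := by exact_mod_cast Fintype.card_pos
  rw [avg, ENNReal.ofReal_mul (by positivity), ENNReal.ofReal_inv_of_pos hV,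
    ENNReal.ofReal_natCast, ENNReal.ofReal_sum_of_nonneg fun w _ => hg w, Finset.mul_sum,
    tsum_fintype]
  simp [PMF.uniformOfFintype_apply]

/-- Internal randomness costs no query, so it can be pulled out in front of the run. -/
theorem run_bind {X : Type} (A : Algorithm) (b : ℕ) (s : A.State) (K : Finset ℕ)
    (p : PMF X) (f : X → A.State) (h : A.step s = p.bind fun i => A.step (f i)) :
    run G ident A b s K = p.bind fun i => run G ident A b (f i) K := by
  cases b <;> simp only [run, h, PMF.bind_bind]

open Classical in
-- The hypothesis `wp` excludes every branch on which `run` would answer `none`; on the others both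
-- sides follow the same recursion.
theorem expect_le_run {k : ℕ} {main : ℕ → ℕ → Prog ℝ} (good : Set ℝ) (p : Prog ℝ) (b : ℕ)
    (K : Finset ℕ) (h : wp G ident p (fun _ _ _ => True) b K) :
    ENNReal.ofReal (expect G ident p (good.indicator 1)) ≤
      (run G ident (birthdaySearch k main) b (.inr p) K).toOuterMeasure (some '' good) := by
  have hnn : ∀ q : Prog ℝ, 0 ≤ expect G ident q (good.indicator 1) := fun q =>
    expect_nonneg fun a => Set.indicator_nonneg (fun _ _ => zero_le_one) _
  induction p generalizing b K with
  | ret a =>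
    have : run G ident (birthdaySearch k main) b (.inr (.ret a)) K = PMF.pure (some a) := by
      cases b <;> simp [run, birthdaySearch, birthdayStep, Prog.action]
    rw [this, PMF.toOuterMeasure_pure_apply]
    by_cases ha : a ∈ good <;> simp [expect, ha]
  | rand c ih =>
    obtain ⟨b, rfl⟩ : ∃ b', b = b' + 1 := ⟨b - 1, by have := h.1; omega⟩
    have : run G ident (birthdaySearch k main) (b + 1) (.inr (.rand c)) K =
        (PMF.uniformOfFintype V).bind fun w => run G ident (birthdaySearch k main) b
          (.inr (c (ident w))) (insert (ident w) K) := by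
      simp [run, birthdaySearch, birthdayStep, Prog.action]
    rw [this, PMF.toOuterMeasure_bind_apply, expect, avg_ofReal _ fun w => hnn _]
    exact ENNReal.tsum_le_tsum fun w => mul_le_mul_right (ih _ _ _ (h.2 w)) _
  | nbr u c ih =>
    obtain ⟨b, rfl⟩ : ∃ b', b = b' + 1 := ⟨b - 1, by have := h.2.1; omega⟩
    have : run G ident (birthdaySearch k main) (b + 1) (.inr (.nbr u c)) K =
        run G ident (birthdaySearch k main) b
          (.inr (c (parentIds G ident u) (childIds G ident u)))
          (K ∪ parentIds G ident u ∪ childIds G ident u) := by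
      simp [run, birthdaySearch, birthdayStep, Prog.action, h.1]
    rw [this, expect]
    exact ih _ _ _ _ h.2.2
  | coin p hp c ih =>
    have : run G ident (birthdaySearch k main) b (.inr (.coin p hp c)) K =
        (Prog.coinPMF p hp).bind fun i => run G ident (birthdaySearch k main) b (.inr (c i)) K :=
      run_bind (birthdaySearch k main) b (.inr (.coin p hp c)) K _ (fun i => .inr (c i)) rfl
    rw [this, PMF.toOuterMeasure_bind_apply, expect, tsum_bool]
    have hp' : (0 : ℝ) ≤ 1 - p := sub_nonneg.2 (by exact_mod_cast hp)
    rw [ENNReal.ofReal_add (mul_nonneg p.coe_nonneg (hnn _)) (mul_nonneg hp' (hnn _)), add_comm,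
      ENNReal.ofReal_mul hp', ENNReal.ofReal_mul p.coe_nonneg]
    refine add_le_add (mul_le_mul' (le_of_eq ?_) (ih _ _ _ (h _)))
      (mul_le_mul' (le_of_eq ?_) (ih _ _ _ (h _)))
    · simp [Prog.coinPMF, ENNReal.ofReal_sub]
    · simp [Prog.coinPMF]
  | pick S hS c ih =>
    have : run G ident (birthdaySearch k main) b (.inr (.pick S hS c)) K =
        (PMF.uniformOfFinset S hS).bind
          fun i => run G ident (birthdaySearch k main) b (.inr (c i)) K :=
      run_bind (birthdaySearch k main) b (.inr (.pick S hS c)) K _ (fun i => .inr (c i)) rfl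
    rw [this, PMF.toOuterMeasure_bind_apply, expect,
      tsum_eq_sum (s := S) fun i hi => by simp [hi]]
    have hS' : (0 : ℝ) < S.card := by exact_mod_cast hS.card_pos
    rw [ENNReal.ofReal_mul (by positivity), ENNReal.ofReal_inv_of_pos hS',
      ENNReal.ofReal_natCast, ENNReal.ofReal_sum_of_nonneg fun w _ => hnn _, Finset.mul_sum]
    refine Finset.sum_le_sum fun i hi => ?_
    rw [PMF.uniformOfFinset_apply_of_mem hS hi]
    exact mul_le_mul_right (ih _ _ _ (h i hi)) _

/-- Here `c` queries are reserved for the continuation. For sample counts at which nothing is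
guaranteed, `ψ` vanishes, and neither correctness nor a query bound is asked for. -/
theorem birthdayValue_le_run [DecidableEq V] {k : ℕ} {main : ℕ → ℕ → Prog ℝ} (good : Set ℝ)
    (v : V) (ψ : ℕ → ℝ) (hψ0 : ∀ q, 0 ≤ ψ q) (c : ℕ)
    (hψ : ∀ q, ψ q = 0 ∨ (ψ q ≤ expect G ident (main (ident v) q) (good.indicator 1) ∧
      ∀ b K, c ≤ b → ident v ∈ K → wp G ident (main (ident v) q) (fun _ _ _ => True) b K))
    (F : ℕ) (l : List V) (b : ℕ) (hb : F + c ≤ b) (K : Finset ℕ) (hK : ident v ∈ K) :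
    ENNReal.ofReal (birthdayValue k ψ F l) ≤
      (run G ident (birthdaySearch k main) b (.inl (ident v, l.map ident)) K).toOuterMeasure
        (some '' good) := by
  have halt : ∀ (l : List V) (b : ℕ) (K : Finset ℕ), c ≤ b → ident v ∈ K → k ≤ collisions l →
      ENNReal.ofReal (ψ l.length) ≤
      (run G ident (birthdaySearch k main) b (.inl (ident v, l.map ident)) K).toOuterMeasure
        (some '' good) := by
    intro l b K hb hK hl
    rcases hψ l.length with h | ⟨h1, h2⟩
    · simp [h]
    have : run G ident (birthdaySearch k main) b (.inl (ident v, l.map ident)) K =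
        run G ident (birthdaySearch k main) b (.inr (main (ident v) l.length)) K := by
      have e : (birthdaySearch k main).step (.inl (ident v, l.map ident)) =
          (birthdaySearch k main).step (.inr (main (ident v) l.length)) := by
        simp [birthdaySearch, birthdayStep, collisions_map, hl]
      cases b <;> simp only [run, e]
    rw [this]
    exact (ENNReal.ofReal_le_ofReal h1).trans (expect_le_run good _ _ _ (h2 b K hb hK))
  induction F generalizing l b K with
  | zero =>
    unfold birthdayValue
    split_ifs with hl
    · exact halt l b K (by omega) hK hl
    · simp
  | succ F ih =>
    unfold birthdayValue
    split_ifs with hl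
    · exact halt l b K (by omega) hK hl
    · obtain ⟨b, rfl⟩ : ∃ b', b = b' + 1 := ⟨b - 1, by omega⟩
      have : run G ident (birthdaySearch k main) (b + 1) (.inl (ident v, l.map ident)) K =
          (PMF.uniformOfFintype V).bind fun w => run G ident (birthdaySearch k main) b
            (.inl (ident v, (w :: l).map ident)) (insert (ident w) K) := by
        simp [run, birthdaySearch, birthdayStep, collisions_map, hl]
      rw [this, PMF.toOuterMeasure_bind_apply,
        avg_ofReal _ fun w => birthdayValue_nonneg hψ0 _ _]
      exact ENNReal.tsum_le_tsum fun w => mul_le_mul_right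
        (ih _ _ (by omega) _ (Finset.mem_insert_of_mem hK)) _

end run

/-! ### Samples of random nodes -/

/-- Prepend `m` random nodes to a list. -/
def Prog.draw : ℕ → List ℕ → Prog (List ℕ)
  | 0, l => .ret l
  | m + 1, l => .rand fun w => draw m (w :: l)

section draw
variable {V : Type*} [Fintype V]

/-- Expectation of `φ` after `m` random nodes have been prepended to `l`. -/
def drawExp : ℕ → List V → (List V → ℝ) → ℝ
  | 0, l, φ => φ l
  | m + 1, l, φ => avg fun w => drawExp m (w :: l) φ

theorem expect_draw {G : Digraph V} {ident : V ↪ ℕ} (m : ℕ) (l : List V) (φ : List ℕ → ℝ) :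
    expect G ident (.draw m (l.map ident)) φ = drawExp m l fun l' => φ (l'.map ident) := by
  induction m generalizing l with
  | zero => rfl
  | succ m ih =>
    simp only [Prog.draw, expect, drawExp]
    congr 1; ext w
    exact ih (w :: l)

theorem wp_draw {G : Digraph V} {ident : V ↪ ℕ} (m b : ℕ) (K : Finset ℕ) (l : List V)
    (hb : m ≤ b) (hK : ∀ x ∈ l.map ident, x ∈ K) :
    wp G ident (.draw m (l.map ident)) (fun b' K' l' => b' = b - m ∧ K ⊆ K' ∧
      (∀ x ∈ l', x ∈ K') ∧ ∃ L : List V, l' = L.map ident ∧ L.length = l.length + m) b K := by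
  induction m generalizing l b K with
  | zero => exact ⟨rfl, subset_rfl, hK, l, rfl, rfl⟩
  | succ m ih =>
    refine ⟨by omega, fun w => wp_mono (ih (b - 1) (insert (ident w) K) (w :: l) (by omega) ?_) ?_⟩
    · intro x hx
      rw [List.map_cons, List.mem_cons] at hx
      rcases hx with rfl | hx
      · exact Finset.mem_insert_self _ _
      · exact Finset.mem_insert_of_mem (hK x hx)
    · rintro b' K' a ⟨h1, h2, h3, L, h4, h5⟩
      refine ⟨by omega, (Finset.subset_insert _ _).trans h2, h3, L, h4, ?_⟩
      rw [h5, List.length_cons]; omega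

theorem drawExp_mono (m : ℕ) (l : List V) {φ ψ : List V → ℝ}
    (h : ∀ l', l'.length = l.length + m → φ l' ≤ ψ l') : drawExp m l φ ≤ drawExp m l ψ := by
  induction m generalizing l with
  | zero => exact h l rfl
  | succ m ih =>
    exact avg_mono fun w => ih _ fun l' hl' => h l' (by rw [hl', List.length_cons]; omega)

theorem drawExp_congr (m : ℕ) (l : List V) {φ ψ : List V → ℝ}
    (h : ∀ l', l'.length = l.length + m → φ l' = ψ l') : drawExp m l φ = drawExp m l ψ :=
  le_antisymm (drawExp_mono m l fun l' hl => (h l' hl).le)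
    (drawExp_mono m l fun l' hl => (h l' hl).ge)

theorem drawExp_add (m : ℕ) (l : List V) (φ ψ : List V → ℝ) :
    drawExp m l (fun l => φ l + ψ l) = drawExp m l φ + drawExp m l ψ := by
  induction m generalizing l with
  | zero => rfl
  | succ m ih => simp only [drawExp, ih, avg_add]

theorem drawExp_mul_left (m : ℕ) (l : List V) (c : ℝ) (φ : List V → ℝ) :
    drawExp m l (fun l => c * φ l) = c * drawExp m l φ := by
  induction m generalizing l with
  | zero => rfl
  | succ m ih => simp only [drawExp, ih, avg_mul_left]

theorem drawExp_const [Nonempty V] (m : ℕ) (l : List V) (c : ℝ) :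
    drawExp m l (fun _ => c) = c := by
  induction m generalizing l with
  | zero => rfl
  | succ m ih => simp only [drawExp, ih, avg_const]

theorem drawExp_nonneg (m : ℕ) (l : List V) {φ : List V → ℝ} (h : ∀ l, 0 ≤ φ l) :
    0 ≤ drawExp m l φ := by
  induction m generalizing l with
  | zero => exact h l
  | succ m ih => exact avg_nonneg fun w => ih _

theorem drawExp_sum {ι : Type*} (s : Finset ι) (m : ℕ) (l : List V) (φ : ι → List V → ℝ) :
    drawExp m l (fun l => ∑ i ∈ s, φ i l) = ∑ i ∈ s, drawExp m l (φ i) := by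
  classical
  induction s using Finset.induction_on with
  | empty =>
    have := drawExp_mul_left m l 0 (fun _ => 0)
    simpa using this
  | insert a s ha ih => simp only [Finset.sum_insert ha, drawExp_add, ih]

/-- Exposes the last random node instead of the first, for conditioning on the earlier ones. -/
theorem drawExp_succ (m : ℕ) (l : List V) (φ : List V → ℝ) :
    drawExp (m + 1) l φ = drawExp m l fun l' => avg fun w => φ (w :: l') := by
  induction m generalizing l with
  | zero => rfl
  | succ m ih =>
    rw [drawExp]
    simp only [ih]
    rfl

/-- Chebyshev's inequality. -/
theorem drawExp_chebyshev (m : ℕ) (l : List V) (X : List V → ℝ) {t : ℝ} (ht : 0 < t)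
    (B : List V → Prop) [DecidablePred B]
    (hB : ∀ l', l'.length = l.length + m → B l' → t ≤ |X l'|) :
    drawExp m l (fun l => if B l then 1 else 0) ≤ drawExp m l (fun l => X l ^ 2) / t ^ 2 := by
  rw [div_eq_inv_mul, ← drawExp_mul_left]
  refine drawExp_mono _ _ fun l' hl' => ?_
  split_ifs with h
  · rw [← sq_abs (X l'), ← div_eq_inv_mul, one_le_div (by positivity)]
    exact pow_le_pow_left₀ ht.le (hB l' hl' h) 2
  · positivity

open Classical in
/-- The probability of missing a set of nodes. -/
theorem drawExp_miss [Nonempty V] (S : Finset V) (m : ℕ) (l : List V) :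
    drawExp m l (fun l => if ∀ x ∈ l, x ∉ S then 1 else 0) ≤
      Real.exp (-(m * (S.card / Fintype.card V))) := by
  have hV : (0 : ℝ) < Fintype.card V := by exact_mod_cast Fintype.card_pos
  have step : avg (fun w : V => if w ∉ S then (1 : ℝ) else 0) ≤
      Real.exp (-(S.card / Fintype.card V)) := by
    have : avg (fun w : V => if w ∉ S then (1 : ℝ) else 0) = -(S.card / Fintype.card V) + 1 := by
      have e : (fun w : V => if w ∉ S then (1 : ℝ) else 0) =
          fun w => 1 + (-1) * (if w ∈ S then (1 : ℝ) else 0) := by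
        ext w; split_ifs <;> simp_all
      rw [e, avg_add, avg_mul_left, avg_const]
      simp [avg, Finset.sum_ite_mem]
      ring
    rw [this]
    exact Real.add_one_le_exp _
  induction m with
  | zero =>
    simp only [drawExp]
    split_ifs <;> simp
  | succ m ih =>
    rw [drawExp_succ]
    calc drawExp m l (fun l' => avg fun w => if ∀ x ∈ w :: l', x ∉ S then (1 : ℝ) else 0)
        = drawExp m l (fun l' => avg (fun w : V => if w ∉ S then (1 : ℝ) else 0) *
            if ∀ x ∈ l', x ∉ S then 1 else 0) := by
          congr 1; ext l'
          rw [mul_comm, ← avg_mul_left]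
          congr 1; ext w
          simp only [List.mem_cons, forall_eq_or_imp]
          split_ifs <;> simp_all
      _ = avg (fun w : V => if w ∉ S then (1 : ℝ) else 0) *
            drawExp m l (fun l => if ∀ x ∈ l, x ∉ S then 1 else 0) := drawExp_mul_left _ _ _ _
      _ ≤ Real.exp (-(S.card / Fintype.card V)) *
            Real.exp (-(m * (S.card / Fintype.card V))) :=
          mul_le_mul step ih (drawExp_nonneg _ _ fun l => by split_ifs <;> simp)
            (Real.exp_pos _).le
      _ = _ := by rw [← Real.exp_add]; congr 1; push_cast; ring

/-! ### Mean and variance of the number of collisions, and the stopping time of the search. -/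

variable [DecidableEq V]

theorem sum_count (l : List V) : ∑ w, (l.count w : ℝ) = l.length := by
  induction l with
  | nil => simp
  | cons x l ih => simp [List.count_cons, Finset.sum_add_distrib, ih]

theorem sum_count_sq (l : List V) :
    ∑ w, (l.count w : ℝ) ^ 2 = l.length + 2 * collisions l := by
  induction l with
  | nil => simp [collisions]
  | cons x l ih =>
    have : ∀ w, ((x :: l).count w : ℝ) ^ 2 =
        (l.count w : ℝ) ^ 2 + ((if x = w then 2 * (l.count w : ℝ) else 0) +
          if x = w then 1 else 0) := by
      intro w
      simp only [List.count_cons, beq_iff_eq]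
      split_ifs <;> push_cast <;> ring
    simp only [this, Finset.sum_add_distrib, ih, Finset.sum_ite_eq, Finset.mem_univ, if_true,
      collisions, List.length_cons]
    push_cast; ring

/-- The expected number of collisions among `m` random nodes. -/
def meanCollisions (V : Type*) [Fintype V] (m : ℕ) : ℝ := m * (m - 1) / (2 * Fintype.card V)

theorem drawExp_collisions [Nonempty V] (m : ℕ) :
    drawExp m ([] : List V) (fun l : List V => (collisions l : ℝ)) = meanCollisions V m := by
  have hV : (Fintype.card V : ℝ) ≠ 0 := by exact_mod_cast Fintype.card_ne_zero
  induction m with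
  | zero => simp [drawExp, collisions, meanCollisions]
  | succ m ih =>
    have : drawExp (m + 1) ([] : List V) (fun l : List V => (collisions l : ℝ)) =
        drawExp m [] fun l : List V => (m : ℝ) / Fintype.card V + (collisions l : ℝ) := by
      rw [drawExp_succ]
      refine drawExp_congr _ _ fun l hl => ?_
      simp only [collisions, Nat.cast_add, avg_add, avg_const]
      rw [avg, sum_count, hl]
      simp; ring
    rw [this, drawExp_add, drawExp_const, ih]
    unfold meanCollisions
    push_cast
    field_simp
    ring

/-- The collision indicators are pairwise independent, so the variance of the number of collisions
is at most its mean. -/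
theorem drawExp_collisions_variance [Nonempty V] (m : ℕ) :
    drawExp m ([] : List V) (fun l : List V => ((collisions l : ℝ) - meanCollisions V m) ^ 2) ≤
      meanCollisions V m := by
  have hV : (0 : ℝ) < Fintype.card V := by exact_mod_cast Fintype.card_pos
  induction m with
  | zero => simp [drawExp, collisions, meanCollisions]
  | succ m ih =>
    set n : ℝ := (Fintype.card V : ℝ) with hn
    have hstep : meanCollisions V (m + 1) = meanCollisions V m + m / n := by
      unfold meanCollisions
      rw [← hn]; push_cast; field_simp; ring
    -- Condition on the first `m` nodes `l`: the last node `w` adds `l.count w` collisions, whose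
    -- first two moments over `w` are `m / n` and `(m + 2 * collisions l) / n`.
    have : drawExp (m + 1) ([] : List V)
          (fun l : List V => ((collisions l : ℝ) - meanCollisions V (m + 1)) ^ 2) =
        drawExp m [] fun l : List V => ((collisions l : ℝ) - meanCollisions V m) ^ 2 +
          ((m / n - m ^ 2 / n ^ 2) + 2 / n * (collisions l : ℝ)) := by
      rw [drawExp_succ]
      refine drawExp_congr _ _ fun l hl => ?_
      have e : ∀ w : V, ((collisions (w :: l) : ℝ) - meanCollisions V (m + 1)) ^ 2 =
          ((collisions l : ℝ) - meanCollisions V m - m / n) ^ 2 + ((l.count w : ℝ) ^ 2 +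
            2 * ((collisions l : ℝ) - meanCollisions V m - m / n) * (l.count w : ℝ)) := by
        intro w
        rw [hstep, collisions]; push_cast; ring
      simp only [e]
      rw [avg_add, avg_add, avg_mul_left, avg_const, avg, avg, sum_count, sum_count_sq, hl, ← hn]
      simp only [List.length_nil, zero_add]
      field_simp
      ring
    rw [this, drawExp_add, drawExp_add, drawExp_const, drawExp_mul_left, drawExp_collisions]
    have h2 : m / n - m ^ 2 / n ^ 2 + 2 / n * meanCollisions V m = m / n - m / n ^ 2 := by
      unfold meanCollisions
      rw [← hn]; field_simp; ring
    have h3 : 0 ≤ m / n ^ 2 := by positivity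
    rw [h2, hstep]
    linarith

theorem drawExp_collisions_chebyshev [Nonempty V] (m : ℕ) {t : ℝ} (ht : 0 < t)
    (B : List V → Prop) [DecidablePred B]
    (hB : ∀ l, l.length = m → B l → t ≤ |(collisions l : ℝ) - meanCollisions V m|) :
    drawExp m ([] : List V) (fun l => if B l then 1 else 0) ≤ meanCollisions V m / t ^ 2 :=
  (drawExp_chebyshev m [] _ ht B fun l hl => hB l (by simpa using hl)).trans
    (div_le_div_of_nonneg_right (drawExp_collisions_variance m) (by positivity))

theorem collisions_le_of_drawExp [Nonempty V] {k : ℕ} (m : ℕ) (l : List V)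
    (hl : k ≤ collisions l) :
    drawExp m l (fun l => if k ≤ collisions l then (1 : ℝ) else 0) = 1 := by
  induction m generalizing l with
  | zero => simp [drawExp, hl]
  | succ m ih =>
    have : ∀ w, drawExp m (w :: l) (fun l => if k ≤ collisions l then (1 : ℝ) else 0) = 1 :=
      fun w => ih _ (hl.trans (Nat.le_add_left _ _))
    simp only [drawExp, this, avg_const]

/-- The search stops at a count in `(q₀, l.length + F]` unless there are `k` collisions already
after `q₀` samples or still too few at the cutoff. Both exceptions concern a fixed number of
samples, which replaces the stopping time by events accessible to Chebyshev. -/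
theorem le_birthdayValue_add [Nonempty V] {k : ℕ} {ψ : ℕ → ℝ} (hψ : ∀ q, 0 ≤ ψ q) {c : ℝ}
    (hc : c ≤ 1) (q₀ F : ℕ) (l : List V) (hψc : ∀ q, q₀ < q → q ≤ l.length + F → c ≤ ψ q) :
    c ≤ birthdayValue k ψ F l +
      drawExp F l (fun l => if collisions l < k then (1 : ℝ) else 0) +
      if l.length ≤ q₀ then
        drawExp (q₀ - l.length) l (fun l => if k ≤ collisions l then (1 : ℝ) else 0) else 0 := by
  have h01 : ∀ p : Prop, ∀ [Decidable p], (0 : ℝ) ≤ if p then 1 else 0 := fun p _ => by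
    split_ifs <;> simp
  have h2 : ∀ F l, 0 ≤ drawExp F l (fun l : List V => if collisions l < k then (1 : ℝ) else 0) :=
    fun F l => drawExp_nonneg _ _ fun l => h01 _
  have h3 : ∀ F l, 0 ≤ drawExp F l (fun l : List V => if k ≤ collisions l then (1 : ℝ) else 0) :=
    fun F l => drawExp_nonneg _ _ fun l => h01 _
  have halt : ∀ (F : ℕ) (l : List V), (∀ q, q₀ < q → q ≤ l.length + F → c ≤ ψ q) →
      k ≤ collisions l → c ≤ ψ l.length + if l.length ≤ q₀ then
        drawExp (q₀ - l.length) l (fun l => if k ≤ collisions l then (1 : ℝ) else 0) else 0 := by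
    intro F l hψc hl
    split_ifs with h
    · rw [collisions_le_of_drawExp _ _ hl]
      linarith [hψ l.length]
    · linarith [hψc l.length (by omega) (by omega)]
  induction F generalizing l with
  | zero =>
    unfold birthdayValue
    by_cases hl : k ≤ collisions l
    · rw [if_pos hl]
      have := halt 0 l hψc hl
      have := h2 0 l
      linarith
    · have h4 : drawExp 0 l (fun l : List V => if collisions l < k then (1 : ℝ) else 0) = 1 := by
        simp [drawExp, not_le.1 hl]
      rw [if_neg hl, h4]
      have := h3 (q₀ - l.length) l
      split_ifs <;> linarith
  | succ F ih =>
    unfold birthdayValue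
    by_cases hl : k ≤ collisions l
    · rw [if_pos hl]
      have := halt (F + 1) l hψc hl
      have := h2 (F + 1) l
      linarith
    · rw [if_neg hl]
      have key : c ≤ avg (fun w => birthdayValue k ψ F (w :: l) +
          drawExp F (w :: l) (fun l => if collisions l < k then (1 : ℝ) else 0) +
          if (w :: l).length ≤ q₀ then drawExp (q₀ - (w :: l).length) (w :: l)
            (fun l => if k ≤ collisions l then (1 : ℝ) else 0) else 0) := by
        rw [← avg_const (V := V) c]
        exact avg_mono fun w => ih (w :: l) fun q hq hq' => hψc q hq (by
          rw [List.length_cons] at hq'; omega)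
      rw [avg_add, avg_add] at key
      refine key.trans (add_le_add le_rfl ?_)
      simp only [List.length_cons]
      by_cases hq : l.length + 1 ≤ q₀
      · rw [if_pos (by omega : l.length ≤ q₀)]
        obtain ⟨j, hj⟩ : ∃ j, q₀ - l.length = j + 1 := ⟨q₀ - l.length - 1, by omega⟩
        simp only [if_pos hq, hj, drawExp]
        rw [show q₀ - (l.length + 1) = j by omega]
      · simp only [if_neg hq, avg_const]
        split_ifs
        · exact h3 _ _
        · exact le_rfl

end draw

/-! ### Linear algebra of damped substochastic matrices -/

section substochastic
variable {V : Type*} [Fintype V] {α : ℝ} {A : V → V → ℝ}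

/-- Minimum principle. -/
theorem nonneg_of_substochastic (h0 : 0 < α) (h1 : α < 1) (hA : ∀ i j, 0 ≤ A i j)
    (hA1 : ∀ i, ∑ j, A i j ≤ 1) {g : V → ℝ}
    (hg : ∀ i, 0 ≤ g i ∨ α * ∑ j, A i j * g j ≤ g i) (i : V) : 0 ≤ g i := by
  obtain ⟨u, -, hu⟩ := Finset.exists_min_image Finset.univ g ⟨i, Finset.mem_univ i⟩
  refine le_trans ?_ (hu i (Finset.mem_univ i))
  rcases hg u with h | h
  · exact h
  by_contra hneg
  rw [not_le] at hneg
  have h2 : (∑ j, A u j) * g u ≤ ∑ j, A u j * g j := by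
    rw [Finset.sum_mul]
    exact Finset.sum_le_sum fun j _ => mul_le_mul_of_nonneg_left (hu j (Finset.mem_univ j)) (hA u j)
  have h3 : g u ≤ (∑ j, A u j) * g u := by nlinarith [hA1 u]
  nlinarith

/-- By the minimum principle for `h` and `-h` the operator `1 - αA` is injective, hence surjective
in finite dimension. -/
theorem exists_potential (h0 : 0 < α) (h1 : α < 1) (hA : ∀ i j, 0 ≤ A i j)
    (hA1 : ∀ i, ∑ j, A i j ≤ 1) (f : V → ℝ) :
    ∃ h : V → ℝ, ∀ i, h i = f i + α * ∑ j, A i j * h j := by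
  let T : (V → ℝ) →ₗ[ℝ] (V → ℝ) :=
    { toFun := fun h i => h i - α * ∑ j, A i j * h j
      map_add' := fun g h => by
        ext i
        simp only [Pi.add_apply, mul_add, Finset.sum_add_distrib]; ring
      map_smul' := fun c h => by
        ext i
        simp only [Pi.smul_apply, smul_eq_mul, RingHom.id_apply, mul_sub, Finset.mul_sum]
        congr 1
        exact Finset.sum_congr rfl fun j _ => by ring }
  have hT : Function.Injective T := by
    rw [injective_iff_map_eq_zero]
    intro h hh
    have e : ∀ i, h i = α * ∑ j, A i j * h j := fun i => sub_eq_zero.1 (congrFun hh i)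
    have p1 := nonneg_of_substochastic h0 h1 hA hA1 (g := h) fun i => .inr (e i).ge
    have p2 := nonneg_of_substochastic h0 h1 hA hA1 (g := fun i => -h i) fun i => .inr (by
      simp only [mul_neg, Finset.sum_neg_distrib]
      linarith [e i])
    ext i
    have := p1 i
    have := p2 i
    simp only [Pi.zero_apply]
    linarith
  obtain ⟨h, hh⟩ := LinearMap.injective_iff_surjective.1 hT f
  refine ⟨h, fun i => ?_⟩
  have := congrFun hh i
  simp only [T, LinearMap.coe_mk, AddHom.coe_mk] at this
  linarith

theorem potential_le (h0 : 0 < α) (h1 : α < 1) (hA : ∀ i j, 0 ≤ A i j)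
    (hA1 : ∀ i, ∑ j, A i j ≤ 1) {f h : V → ℝ} (hh : ∀ i, h i = f i + α * ∑ j, A i j * h j)
    {F : ℝ} (hF : 0 ≤ F) (hf : ∀ i, f i ≤ F) (i : V) : h i ≤ F / (1 - α) := by
  have h1' : 0 < 1 - α := sub_pos.2 h1
  have := nonneg_of_substochastic h0 h1 hA hA1 (g := fun i => F / (1 - α) - h i) (fun i => .inr (by
    simp only [mul_sub, Finset.sum_sub_distrib, ← Finset.sum_mul]
    have e : F / (1 - α) - h i = F - f i + α * (F / (1 - α)) - α * ∑ j, A i j * h j := by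
      rw [hh i]; field_simp; ring
    rw [e]
    have : α * ((∑ j, A i j) * (F / (1 - α))) ≤ α * (F / (1 - α)) :=
      mul_le_mul_of_nonneg_left (mul_le_of_le_one_left (by positivity) (hA1 i)) h0.le
    linarith [hf i])) i
  linarith

theorem potential_nonneg (h0 : 0 < α) (h1 : α < 1) (hA : ∀ i j, 0 ≤ A i j)
    (hA1 : ∀ i, ∑ j, A i j ≤ 1) {f h : V → ℝ} (hh : ∀ i, h i = f i + α * ∑ j, A i j * h j)
    (hf : ∀ i, 0 ≤ f i) (i : V) : 0 ≤ h i :=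
  nonneg_of_substochastic h0 h1 hA hA1 (fun i => .inr (by linarith [hh i, hf i])) i

end substochastic

/-! ### Basic properties of PageRank -/

section pageRank
variable {V : Type*} [Fintype V] {α : ℝ} {G : Digraph V}

theorem sum_pageRank_mul (h0 : 0 < α) (h1 : α < 1) (g : V → ℝ) :
    ∑ j, pageRank α G j * g j =
      α * ∑ i, pageRank α G i * ∑ j, transition G i j * g j + (1 - α) * avg g := by
  have h := (eq_pageRank_iff h0 h1 G (pageRank α G)).1 rfl
  calc ∑ j, pageRank α G j * g j
      = ∑ j, (α * (∑ i, pageRank α G i * transition G i j) * g j +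
          (1 - α) * (Fintype.card V : ℝ)⁻¹ * g j) :=
        Finset.sum_congr rfl fun j _ => by rw [← add_mul, ← h j]
    _ = _ := by
      rw [Finset.sum_add_distrib, ← Finset.mul_sum, avg, mul_assoc (1 - α)]
      congr 1
      simp only [mul_assoc, ← Finset.mul_sum, Finset.sum_mul]
      rw [Finset.sum_comm]
      simp only [Finset.mul_sum]

/-- Pair the PageRank equation with `h`; the terms containing the transition matrix cancel. -/
theorem sum_pageRank_mul_potential (h0 : 0 < α) (h1 : α < 1) {f h : V → ℝ}
    (hh : ∀ i, h i = f i + α * ∑ j, transition G i j * h j) :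
    ∑ i, pageRank α G i * f i = (1 - α) * avg h := by
  have h2 := sum_pageRank_mul (G := G) h0 h1 h
  have h3 : ∑ i, pageRank α G i * h i = ∑ i, pageRank α G i * f i +
      α * ∑ i, pageRank α G i * ∑ j, transition G i j * h j := by
    rw [Finset.mul_sum, ← Finset.sum_add_distrib]
    refine Finset.sum_congr rfl fun i _ => ?_
    conv_lhs => rw [hh i]
    ring
  linarith

theorem pageRank_ge (h0 : 0 < α) (h1 : α < 1) (v : V) :
    (1 - α) / Fintype.card V ≤ pageRank α G v := by
  classical
  have hT := fun i => (transition_row_sum G i).le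
  obtain ⟨h, hh⟩ := exists_potential h0 h1 (transition_nonneg G) hT (fun i => if i = v then 1 else 0)
  have hn := potential_nonneg h0 h1 (transition_nonneg G) hT hh fun i => by split_ifs <;> simp
  have e := sum_pageRank_mul_potential h0 h1 hh
  simp only [mul_ite, mul_one, mul_zero, Finset.sum_ite_eq', Finset.mem_univ, if_true] at e
  have hv : 1 ≤ h v := by
    rw [hh v, if_pos rfl]
    have : 0 ≤ ∑ j, transition G v j * h j :=
      Finset.sum_nonneg fun j _ => mul_nonneg (transition_nonneg G v j) (hn j)
    nlinarith
  have h3 : 1 ≤ ∑ i, h i :=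
    hv.trans (Finset.single_le_sum (fun i _ => hn i) (Finset.mem_univ v))
  rw [e, avg, div_eq_mul_inv]
  refine mul_le_mul_of_nonneg_left ?_ (sub_pos.2 h1).le
  exact le_mul_of_one_le_right (by positivity) h3

theorem pageRank_pos (h0 : 0 < α) (h1 : α < 1) (v : V) : 0 < pageRank α G v := by
  have : Nonempty V := ⟨v⟩
  have hV : (0 : ℝ) < Fintype.card V := by exact_mod_cast Fintype.card_pos
  exact (div_pos (sub_pos.2 h1) hV).trans_le (pageRank_ge h0 h1 v)

theorem sum_pageRank [Nonempty V] (h0 : 0 < α) (h1 : α < 1) : ∑ i, pageRank α G i = 1 := by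
  have h := sum_pageRank_mul (G := G) h0 h1 fun _ => 1
  simp only [mul_one, transition_row_sum, avg_const] at h
  nlinarith

/-! ### Core weights -/

open Classical in
/-- The transition matrix with zero rows at the childless nodes. -/
def follow (G : Digraph V) (u x : V) : ℝ :=
  if x ∈ children G u then ((children G u).card : ℝ)⁻¹ else 0

theorem follow_nonneg (u x : V) : 0 ≤ follow G u x := by
  unfold follow; split_ifs <;> positivity

theorem sum_follow_mul (u : V) (g : V → ℝ) :
    ∑ x, follow G u x * g x = ((children G u).card : ℝ)⁻¹ * ∑ x ∈ children G u, g x := by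
  classical
  simp only [follow, ite_mul, zero_mul, Finset.sum_ite_mem, Finset.univ_inter, ← Finset.mul_sum]

theorem sum_follow_le (u : V) : ∑ x, follow G u x ≤ 1 := by
  have := sum_follow_mul (G := G) u fun _ => 1
  simp only [mul_one, Finset.sum_const, nsmul_eq_mul] at this
  rw [this]
  exact inv_mul_le_one

open Classical in
theorem sum_transition_mul (u : V) (g : V → ℝ) :
    ∑ x, transition G u x * g x =
      ∑ x, follow G u x * g x + if children G u = ∅ then avg g else 0 := by
  split_ifs with h
  · rw [sum_follow_mul, h]
    simp [transition, h, avg, Finset.mul_sum]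
  · simp [transition, h, follow]

open Classical in
/-- `e` is the vector of the damped numbers of visits at `v` of walks inside the core `Q`. -/
def IsCoreWeight (α : ℝ) (G : Digraph V) (v : V) (Q : Finset V) (e : V → ℝ) : Prop :=
  ∀ u, e u = if u ∈ Q then (if u = v then 1 else 0) + α * ∑ x, follow G u x * e x else 0

/-- The residual of a node, relative to weights of a core. -/
def residual (α : ℝ) (G : Digraph V) (e : V → ℝ) (w : V) : ℝ := α * ∑ x, follow G w x * e x

theorem exists_isCoreWeight (h0 : 0 < α) (h1 : α < 1) (v : V) (Q : Finset V) :
    ∃ e, IsCoreWeight α G v Q e := by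
  classical
  obtain ⟨e, he⟩ := exists_potential h0 h1 (A := fun u x => if u ∈ Q then follow G u x else 0)
    (fun i j => by split_ifs <;> simp [follow_nonneg])
    (fun i => by split_ifs <;> simp [sum_follow_le]) (fun u => if u ∈ Q ∧ u = v then 1 else 0)
  refine ⟨e, fun u => ?_⟩
  rw [he u]
  by_cases h : u ∈ Q <;> simp [h]

variable {v : V} {Q Q' : Finset V} {e e' : V → ℝ}

/-- The difference satisfies the minimum principle: on `Q` both equations hold and their sources
cancel, and outside `Q` the smaller weight vanishes. -/
theorem IsCoreWeight.mono (h0 : 0 < α) (h1 : α < 1) (he : IsCoreWeight α G v Q e)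
    (he' : IsCoreWeight α G v Q' e') (hQ : Q ⊆ Q') (hnn : ∀ u, 0 ≤ e' u) (u : V) :
    e u ≤ e' u := by
  refine sub_nonneg.1 (nonneg_of_substochastic h0 h1 (follow_nonneg (G := G)) sum_follow_le
    (g := fun u => e' u - e u) (fun u => ?_) u)
  by_cases h : u ∈ Q
  · right
    have h2 := he u
    have h3 := he' u
    rw [if_pos h] at h2
    rw [if_pos (hQ h)] at h3
    simp only [mul_sub, Finset.sum_sub_distrib]
    linarith
  · left
    have h2 := he u
    rw [if_neg h] at h2
    rw [h2, sub_zero]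
    exact hnn u

theorem IsCoreWeight.nonneg (h0 : 0 < α) (h1 : α < 1) (he : IsCoreWeight α G v Q e) (u : V) :
    0 ≤ e u := by
  classical
  refine nonneg_of_substochastic h0 h1 (follow_nonneg (G := G)) sum_follow_le (fun u => ?_) u
  have h2 := he u
  by_cases h : u ∈ Q
  · right
    rw [if_pos h] at h2
    have : (0 : ℝ) ≤ if u = v then 1 else 0 := by split_ifs <;> simp
    linarith
  · left; rw [h2, if_neg h]

theorem IsCoreWeight.unique (h0 : 0 < α) (h1 : α < 1) (he : IsCoreWeight α G v Q e)
    (he' : IsCoreWeight α G v Q e') : e = e' :=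
  funext fun u => le_antisymm (he.mono h0 h1 he' subset_rfl (he'.nonneg h0 h1) u)
    (he'.mono h0 h1 he subset_rfl (he.nonneg h0 h1) u)

theorem residual_nonneg (h0 : 0 < α) (hnn : ∀ u, 0 ≤ e u) (w : V) : 0 ≤ residual α G e w :=
  mul_nonneg h0.le (Finset.sum_nonneg fun x _ => mul_nonneg (follow_nonneg w x) (hnn x))

/-- The weight of a node of a larger core is at least its residual. -/
theorem IsCoreWeight.residual_le (h0 : 0 < α) (h1 : α < 1) (he : IsCoreWeight α G v Q e)
    (he' : IsCoreWeight α G v Q' e') (hQ : Q ⊆ Q') {w : V} (hw : w ∈ Q') :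
    residual α G e w ≤ e' w := by
  classical
  have h2 : residual α G e w ≤ residual α G e' w :=
    mul_le_mul_of_nonneg_left (Finset.sum_le_sum fun x _ => mul_le_mul_of_nonneg_left
      (he.mono h0 h1 he' hQ (he'.nonneg h0 h1) x) (follow_nonneg w x)) h0.le
  have h3 : (0 : ℝ) ≤ if w = v then 1 else 0 := by split_ifs <;> simp
  have h4 := he' w
  rw [if_pos hw] at h4
  unfold residual at h2 ⊢
  linarith

open Classical in
/-- The function on the nodes whose mean with respect to PageRank is the PageRank of `v`. -/
def coreEstimate (α : ℝ) (G : Digraph V) (Q : Finset V) (e : V → ℝ) (w : V) : ℝ :=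
  (if w ∈ Q then 0 else residual α G e w) +
    avg e * ((1 - α) + α * if children G w = ∅ then 1 else 0)

/-- Both inside and outside `Q` the estimate equals `1_v - e + αMe + (1-α) avg e`. The PageRank
equation paired with `e` kills everything but `1_v`. -/
theorem sum_pageRank_mul_coreEstimate (h0 : 0 < α) (h1 : α < 1) (he : IsCoreWeight α G v Q e)
    (hv : v ∈ Q) : ∑ w, pageRank α G w * coreEstimate α G Q e w = pageRank α G v := by
  classical
  have : Nonempty V := ⟨v⟩
  have s1 : ∀ w, coreEstimate α G Q e w = (if w = v then 1 else 0) - e w +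
      α * (∑ x, transition G w x * e x) + (1 - α) * avg e := by
    intro w
    rw [sum_transition_mul, coreEstimate]
    have h2 := he w
    by_cases hw : w ∈ Q
    · rw [if_pos hw] at h2 ⊢
      split_ifs at h2 ⊢ <;> linarith
    · rw [if_neg hw] at h2 ⊢
      rw [if_neg (fun h : w = v => hw (h ▸ hv)), h2, residual]
      split_ifs <;> ring
  have h3 := sum_pageRank_mul (G := G) h0 h1 e
  have h4 := sum_pageRank (G := G) h0 h1
  calc ∑ w, pageRank α G w * coreEstimate α G Q e w
      = ∑ w, (pageRank α G w * (if w = v then 1 else 0) - pageRank α G w * e w +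
        α * (pageRank α G w * ∑ x, transition G w x * e x) +
          pageRank α G w * ((1 - α) * avg e)) :=
        Finset.sum_congr rfl fun w _ => by rw [s1]; ring
    _ = pageRank α G v := by
      rw [Finset.sum_add_distrib, Finset.sum_add_distrib, Finset.sum_sub_distrib,
        ← Finset.mul_sum, ← Finset.sum_mul, h4, h3]
      simp only [mul_ite, mul_one, mul_zero, Finset.sum_ite_eq', Finset.mem_univ, if_true]
      ring

theorem coreEstimate_nonneg (h0 : 0 < α) (h1 : α < 1) (hnn : ∀ u, 0 ≤ e u) (w : V) :
    0 ≤ coreEstimate α G Q e w := by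
  unfold coreEstimate
  have h1' : 0 < 1 - α := sub_pos.2 h1
  have := avg_nonneg hnn
  refine add_nonneg (by split_ifs <;> simp [residual_nonneg h0 hnn]) (mul_nonneg this ?_)
  split_ifs <;> linarith

/-- The estimate is pointwise at least `(1-α) avg e`, and its PageRank-mean is `P(v)`. -/
theorem avg_coreWeight_le (h0 : 0 < α) (h1 : α < 1) (he : IsCoreWeight α G v Q e)
    (hv : v ∈ Q) : avg e ≤ pageRank α G v / (1 - α) := by
  classical
  have : Nonempty V := ⟨v⟩
  have h1' : 0 < 1 - α := sub_pos.2 h1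
  have hnn := he.nonneg h0 h1
  have ha := avg_nonneg hnn
  rw [le_div_iff₀ h1', ← sum_pageRank_mul_coreEstimate h0 h1 he hv]
  calc avg e * (1 - α) = ∑ w, pageRank α G w * (avg e * (1 - α)) := by
        rw [← Finset.sum_mul, sum_pageRank h0 h1, one_mul]
    _ ≤ _ := Finset.sum_le_sum fun w _ => mul_le_mul_of_nonneg_left ?_ (pageRank_pos h0 h1 w).le
  unfold coreEstimate
  rw [mul_add]
  have h2 : 0 ≤ avg e * (α * if children G w = ∅ then (1 : ℝ) else 0) :=
    mul_nonneg ha (by split_ifs <;> simp [h0.le])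
  have h3 : 0 ≤ if w ∈ Q then 0 else residual α G e w := by
    split_ifs <;> simp [residual_nonneg h0 hnn]
  linarith

theorem coreEstimate_le (h0 : 0 < α) (h1 : α < 1) (he : IsCoreWeight α G v Q e) (hv : v ∈ Q)
    {θ : ℝ} (hθ : 0 ≤ θ) (hr : ∀ w ∉ Q, residual α G e w ≤ θ) (w : V) :
    coreEstimate α G Q e w ≤ θ + pageRank α G v / (1 - α) := by
  unfold coreEstimate
  have ha := avg_nonneg (he.nonneg h0 h1)
  refine add_le_add ?_ ((mul_le_of_le_one_right ha ?_).trans (avg_coreWeight_le h0 h1 he hv))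
  · split_ifs with h
    · exact hθ
    · exact hr w h
  · split_ifs <;> linarith

end pageRank

/-! ### The random surfer -/

/-- Walk `t` steps of the random surfer from `x`, accumulating the values `F` of the visited nodes
and their children. -/
def Prog.surf (α : NNReal) (hα : α ≤ 1) (F : ℕ → Finset ℕ → ℝ × ℝ) :
    ℕ → ℝ × ℝ → ℕ → Prog (ℝ × ℝ)
  | 0, s, _ => .ret s
  | t + 1, s, x => .nbr x fun _ C => .coin α hα fun i =>
      if h : i = true ∧ C.Nonempty then .pick C h.2 fun y => surf α hα F t (s + F x C) y
      else .rand fun y => surf α hα F t (s + F x C) y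

section surf
variable {V : Type*} [Fintype V] {G : Digraph V} {ident : V ↪ ℕ}

theorem childIds_ident (x : V) : childIds G ident (ident x) = (children G x).map ident := by
  classical
  ext y
  simp only [childIds, Finset.mem_biUnion, Finset.mem_univ, true_and]
  refine ⟨?_, fun h => ⟨x, by rwa [if_pos rfl]⟩⟩
  rintro ⟨a, ha⟩
  split_ifs at ha with e
  · rwa [← ident.injective e]
  · simp at ha

theorem parentIds_ident (x : V) : parentIds G ident (ident x) = (parents G x).map ident := by
  classical
  ext y
  simp only [parentIds, Finset.mem_biUnion, Finset.mem_univ, true_and]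
  refine ⟨?_, fun h => ⟨x, by rwa [if_pos rfl]⟩⟩
  rintro ⟨a, ha⟩
  split_ifs at ha with e
  · rwa [← ident.injective e]
  · simp at ha

/-- The Markov operator of the random surfer. -/
def jump (α : ℝ) (G : Digraph V) (g : V → ℝ) (x : V) : ℝ :=
  α * ∑ y, transition G x y * g y + (1 - α) * avg g

/-- Expectation after `t` steps of the surfer. -/
def surfExp (α : ℝ) (G : Digraph V) (f : V → ℝ × ℝ) : ℕ → ℝ × ℝ → V → (ℝ × ℝ → ℝ) → ℝ
  | 0, s, _, φ => φ s
  | t + 1, s, x, φ => jump α G (fun y => surfExp α G f t (s + f x) y φ) x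

theorem expect_surf (α : NNReal) (hα : α ≤ 1) (F : ℕ → Finset ℕ → ℝ × ℝ) (t : ℕ) (s : ℝ × ℝ)
    (x : V) (φ : ℝ × ℝ → ℝ) :
    expect G ident (.surf α hα F t s (ident x)) φ =
      surfExp α G (fun x => F (ident x) ((children G x).map ident)) t s x φ := by
  classical
  induction t generalizing s x with
  | zero => rfl
  | succ t ih =>
    rw [Prog.surf, expect, childIds_ident, expect, surfExp, jump]
    congr 1
    · congr 1
      -- At a childless node the successful coin also leads to `RandomNode()`, which is the uniform
      -- row of the transition matrix.
      by_cases h : children G x = ∅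
      · rw [sum_transition_mul, if_pos h, sum_follow_mul, dif_neg (by simp [h]), h]
        simp only [expect, ih, Finset.sum_empty, mul_zero, zero_add, Finset.map_empty]
      · rw [sum_transition_mul, if_neg h, sum_follow_mul]
        simp only [Finset.map_nonempty, Finset.nonempty_iff_ne_empty.2 h, and_self, dite_true,
          add_zero, expect, Finset.card_map, Finset.sum_map, ih]
    · simp only [Bool.false_eq_true, false_and, dite_false, expect, ih]

theorem wp_surf (α : NNReal) (hα : α ≤ 1) (F : ℕ → Finset ℕ → ℝ × ℝ) (t : ℕ) (s : ℝ × ℝ)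
    (x : V) (b : ℕ) (K : Finset ℕ) (hb : 2 * t ≤ b) (hx : ident x ∈ K) {P : ℝ × ℝ → Prop}
    (hP : ∀ s y C, P s → P (s + F y C)) (hs : P s) :
    wp G ident (.surf α hα F t s (ident x)) (fun _ _ s => P s) b K := by
  induction t generalizing s x b K with
  | zero => exact hs
  | succ t ih =>
    rw [Prog.surf]
    refine ⟨hx, by omega, fun i => ?_⟩
    beta_reduce
    split_ifs with h
    · intro y hy
      have hy' := hy
      rw [childIds_ident, Finset.mem_map] at hy'
      obtain ⟨z, -, rfl⟩ := hy'
      exact ih _ z _ _ (by omega) (Finset.mem_union_right _ hy) (hP _ _ _ hs)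
    · exact ⟨by omega, fun w => ih _ w _ _ (by omega) (Finset.mem_insert_self _ _) (hP _ _ _ hs)⟩

variable {α : ℝ}

theorem jump_mono (h0 : 0 < α) (h1 : α < 1) {f g : V → ℝ} (h : ∀ x, f x ≤ g x) (x : V) :
    jump α G f x ≤ jump α G g x :=
  add_le_add (mul_le_mul_of_nonneg_left (Finset.sum_le_sum fun y _ =>
    mul_le_mul_of_nonneg_left (h y) (transition_nonneg G x y)) h0.le)
    (mul_le_mul_of_nonneg_left (avg_mono h) (sub_pos.2 h1).le)

theorem jump_add (f g : V → ℝ) (x : V) :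
    jump α G (fun y => f y + g y) x = jump α G f x + jump α G g x := by
  simp only [jump, mul_add, Finset.sum_add_distrib, avg_add]; ring

theorem jump_mul_left (c : ℝ) (f : V → ℝ) (x : V) :
    jump α G (fun y => c * f y) x = c * jump α G f x := by
  simp only [jump, avg_mul_left, mul_left_comm _ c, ← Finset.mul_sum]; ring

theorem jump_const [Nonempty V] (c : ℝ) (x : V) : jump α G (fun _ => c) x = c := by
  simp only [jump, avg_const, ← Finset.sum_mul, transition_row_sum]; ring

theorem surfExp_mono (h0 : 0 < α) (h1 : α < 1) (f : V → ℝ × ℝ) (t : ℕ) (s : ℝ × ℝ) (x : V)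
    {φ ψ : ℝ × ℝ → ℝ} (h : ∀ z, φ z ≤ ψ z) : surfExp α G f t s x φ ≤ surfExp α G f t s x ψ := by
  induction t generalizing s x with
  | zero => exact h s
  | succ t ih => exact jump_mono h0 h1 (fun y => ih _ y) x

theorem surfExp_mul_left (f : V → ℝ × ℝ) (t : ℕ) (s : ℝ × ℝ) (x : V) (c : ℝ)
    (φ : ℝ × ℝ → ℝ) : surfExp α G f t s x (fun z => c * φ z) = c * surfExp α G f t s x φ := by
  induction t generalizing s x with
  | zero => rfl
  | succ t ih => simp only [surfExp, ih, jump_mul_left]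

/-- Mean of the centred sum of `g` over `t` steps of the surfer. -/
def surfMean (α : ℝ) (G : Digraph V) (g : V → ℝ) (p : ℝ) : ℕ → V → ℝ
  | 0, _ => 0
  | t + 1, x => g x - p + jump α G (surfMean α G g p t) x

/-- Second moment of the centred sum of `g` over `t` steps of the surfer. -/
def surfSq (α : ℝ) (G : Digraph V) (g : V → ℝ) (p : ℝ) : ℕ → V → ℝ
  | 0, _ => 0
  | t + 1, x => (g x - p) ^ 2 + 2 * (g x - p) * jump α G (surfMean α G g p t) x +
      jump α G (surfSq α G g p t) x

/-- The two coordinates are accumulated separately so that the analysis can use the exact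
coefficient `c = avg e`; the estimate of `1/n` enters only in the final output. -/
theorem surfExp_sq [Nonempty V] (f : V → ℝ × ℝ) (c p k : ℝ) (t : ℕ) (s : ℝ × ℝ) (x : V) :
    surfExp α G f t s x (fun z => (z.1 + c * z.2 - k) ^ 2) =
      (s.1 + c * s.2 + t * p - k) ^ 2 + 2 * (s.1 + c * s.2 + t * p - k) *
        surfMean α G (fun x => (f x).1 + c * (f x).2) p t x +
          surfSq α G (fun x => (f x).1 + c * (f x).2) p t x := by
  induction t generalizing s x with
  | zero => simp [surfExp, surfMean, surfSq]
  | succ t ih =>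
    simp only [surfExp, ih, jump_add, jump_mul_left, jump_const, surfMean, surfSq, Prod.fst_add,
      Prod.snd_add]
    push_cast
    ring

/-- Mean square error of the ergodic average of the surfer, through the solution `h` of the Poisson
equation. -/
theorem surfExp_sq_le [Nonempty V] (h0 : 0 < α) (h1 : α < 1) (f : V → ℝ × ℝ) (c : ℝ) {h : V → ℝ}
    {H p : ℝ} (hf : ∀ x, 0 ≤ (f x).1 + c * (f x).2)
    (hh : ∀ x, h x = (f x).1 + c * (f x).2 + α * ∑ y, transition G x y * h y)
    (hp : p = (1 - α) * avg h) (hH : ∀ x, h x ≤ H) (t : ℕ) (x : V) :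
    surfExp α G f t 0 x (fun z => (z.1 + c * z.2 - t * p) ^ 2) ≤ 6 * H * p * t + 4 * H ^ 2 := by
  set g : V → ℝ := fun x => (f x).1 + c * (f x).2 with hg
  have hn : ∀ x, 0 ≤ h x := potential_nonneg h0 h1 (transition_nonneg G)
    (fun i => (transition_row_sum G i).le) hh hf
  have hgH : ∀ x, g x ≤ H := fun x => by
    have : 0 ≤ ∑ y, transition G x y * h y :=
      Finset.sum_nonneg fun j _ => mul_nonneg (transition_nonneg G x j) (hn j)
    have := mul_nonneg h0.le this
    have := hh x
    have := hH x
    simp only [hg]; linarith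
  have h1' : 0 < 1 - α := sub_pos.2 h1
  have hH0 : 0 ≤ H := (hn x).trans (hH x)
  have hp0 : 0 ≤ p := hp ▸ mul_nonneg h1'.le (avg_nonneg hn)
  have hpH : p ≤ H := by
    have : avg h ≤ H := by
      rw [← avg_const (V := V) H]; exact avg_mono hH
    rw [hp]
    exact (mul_le_of_le_one_left (avg_nonneg hn) (by linarith)).trans this
  have hj : ∀ x, jump α G h x = h x - g x + p := fun x => by
    rw [jump, hp, hh x]; ring
  -- Since `g - p = h - jump h`, the centred sum telescopes: its mean is `h x` minus the expectation
  -- of `h` after `t` steps, a number in `[0, H]`.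
  have hm : ∀ t x, h x - H ≤ surfMean α G g p t x ∧ surfMean α G g p t x ≤ h x := by
    intro t
    induction t with
    | zero => intro x; exact ⟨by linarith [hH x, surfMean.eq_1 α G g p x], hn x⟩
    | succ t ih =>
      intro x
      have l1 := jump_mono (G := G) h0 h1 (fun y => (ih y).1) x
      have l2 := jump_mono (G := G) h0 h1 (fun y => (ih y).2) x
      have l3 : jump α G (fun y => h y - H) x = jump α G h x - H := by
        have := jump_add (α := α) (G := G) h (fun _ => -H) x
        rw [jump_const] at this
        simpa only [← sub_eq_add_neg] using this
      rw [l3, hj] at l1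
      rw [hj] at l2
      rw [surfMean]
      constructor <;> linarith
  -- The term `4 * H * h x` acts as a potential. One step changes its mean by `4H(p - g)`, which
  -- absorbs the cross term `2(g - p)a ≤ 2Hg + 2Hp` and leaves `6Hp`; thus the growth per step is of
  -- order `Hp` rather than `H²`.
  have hsq : ∀ t x, surfSq α G g p t x ≤ 6 * H * p * t + 4 * H * h x := by
    intro t
    induction t with
    | zero =>
      intro x
      have : 0 ≤ H * h x := mul_nonneg hH0 (hn x)
      rw [surfSq]; push_cast; linarith
    | succ t ih =>
      intro x
      have l1 := jump_mono (G := G) h0 h1 ih x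
      rw [jump_add, jump_const, jump_mul_left, hj] at l1
      obtain ⟨m1, m2⟩ := hm (t + 1) x
      have e : jump α G (surfMean α G g p t) x = surfMean α G g p (t + 1) x - (g x - p) := by
        rw [surfMean]; ring
      rw [surfSq, e]
      set a := surfMean α G g p (t + 1) x
      have ha1 : -H ≤ a := by linarith [hn x]
      have ha2 : a ≤ H := by linarith [hH x]
      have hgx : 0 ≤ g x := hf x
      have i1 := mul_le_mul_of_nonneg_left ha2 hgx
      have i2 := mul_le_mul_of_nonneg_left ha1 hp0
      have i3 := mul_le_mul_of_nonneg_left hpH hgx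
      have i4 := sq_nonneg (g x)
      have i5 := sq_nonneg p
      push_cast
      nlinarith
  rw [surfExp_sq (p := p)]
  simp only [Prod.fst_zero, Prod.snd_zero, mul_zero, add_zero, zero_add, sub_self]
  have := hsq t x
  have : 4 * H * h x ≤ 4 * H * H := mul_le_mul_of_nonneg_left (hH x) (by linarith)
  nlinarith

theorem surfExp_chebyshev (h0 : 0 < α) (h1 : α < 1) (f : V → ℝ × ℝ) (t : ℕ) (s : ℝ × ℝ) (x : V)
    (X : ℝ × ℝ → ℝ) {d : ℝ} (hd : 0 < d) (B : ℝ × ℝ → Prop) [DecidablePred B]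
    (hB : ∀ z, B z → d ≤ |X z|) :
    surfExp α G f t s x (fun z => if B z then 1 else 0) ≤
      surfExp α G f t s x (fun z => X z ^ 2) / d ^ 2 := by
  rw [div_eq_inv_mul, ← surfExp_mul_left]
  refine surfExp_mono h0 h1 _ _ _ _ fun z => ?_
  split_ifs with h
  · rw [← sq_abs (X z), ← div_eq_inv_mul, one_le_div (by positivity)]
    exact pow_le_pow_left₀ hd.le (hB z h) 2
  · positivity

end surf

/-! ### Exploration of a core around the target node -/

/-- Recorded parents and children of nodes. -/
abbrev Table := ℕ → Finset ℕ × Finset ℕ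

/-- Query all the nodes of a list and record the answers. -/
def Prog.look : List ℕ → Table → Prog Table
  | [], T => .ret T
  | u :: l, T => .nbr u fun A B => look l (Function.update T u (A, B))

/-- The core weights, as determined from a table. -/
def tableWeight (α : ℝ) (v : ℕ) (Q : Finset ℕ) (T : Table) : ℕ → ℝ :=
  Classical.epsilon fun e : ℕ → ℝ => ∀ u, e u = if u ∈ Q then (if u = v then 1 else 0) +
    α * (((T u).2.card : ℝ)⁻¹ * ∑ x ∈ (T u).2, e x) else 0

/-- Upper estimate of the residual of `w`, where `d` estimates the numbers of children. -/
def tableBound (α : ℝ) (v : ℕ) (d : ℕ → ℕ) (Q : Finset ℕ) (T : Table) (w : ℕ) : ℝ :=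
  α * (∑ u ∈ Q with w ∈ (T u).1, tableWeight α v Q T u) / d w

/-- The nodes outside `Q` known to have a child in `Q`. -/
def frontier (Q : Finset ℕ) (T : Table) : Finset ℕ := (Q.biUnion fun u => (T u).1) \ Q

/-- A frontier node with the largest estimated residual. -/
def nextNode (α : ℝ) (v : ℕ) (d : ℕ → ℕ) (Q : Finset ℕ) (T : Table)
    (h : (frontier Q T).Nonempty) : ℕ :=
  (Finset.exists_max_image (frontier Q T) (tableBound α v d Q T) h).choose

open Classical in
/-- The largest estimated residual of a frontier node. -/
def maxBound (α : ℝ) (v : ℕ) (d : ℕ → ℕ) (Q : Finset ℕ) (T : Table) : ℝ :=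
  if h : (frontier Q T).Nonempty then tableBound α v d Q T (nextNode α v d Q T h) else 0

open Classical in
/-- Add to the core `Q`, `j` times, a frontier node with the largest estimated residual. -/
def Prog.explore (α : ℝ) (v : ℕ) (d : ℕ → ℕ) : ℕ → Finset ℕ → Table → Prog (Finset ℕ × Table)
  | 0, Q, T => .ret (Q, T)
  | j + 1, Q, T =>
    if h : (frontier Q T).Nonempty then
      .nbr (nextNode α v d Q T h) fun A B => explore α v d j (insert (nextNode α v d Q T h) Q)
        (Function.update T (nextNode α v d Q T h) (A, B))
    else .ret (Q, T)

open Classical in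
/-- A subset of the explored core for which the largest estimated residual is smallest. -/
def bestCore (α : ℝ) (v : ℕ) (d : ℕ → ℕ) (Q : Finset ℕ) (T : Table) : Finset ℕ :=
  if h : (Q.powerset.filter fun Q' => v ∈ Q').Nonempty then
    (Finset.exists_min_image _ (fun Q' => maxBound α v d Q' T) h).choose
  else Q

/-! ### Correctness of the exploration. -/

section explore
variable {V : Type*} [Fintype V] {G : Digraph V} {ident : V ↪ ℕ} {α : ℝ} {v : V} {d : ℕ → ℕ}
  {Q : Finset V} {T : Table}

/-- The entry of a table at `u` is correct. -/
def Table.CorrectAt (G : Digraph V) (ident : V ↪ ℕ) (T : Table) (u : ℕ) : Prop :=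
  T u = (parentIds G ident u, childIds G ident u)

theorem Table.CorrectAt.update {u : ℕ} (h : T.CorrectAt G ident u) (w : ℕ) :
    Table.CorrectAt G ident (Function.update T w (parentIds G ident w, childIds G ident w)) u := by
  unfold Table.CorrectAt at *
  by_cases e : u = w
  · subst e; simp
  · rw [Function.update_of_ne e, h]

theorem Table.correctAt_update (T : Table) (w : ℕ) :
    Table.CorrectAt G ident (Function.update T w (parentIds G ident w, childIds G ident w)) w := by
  simp [Table.CorrectAt]

theorem wp_look (l : List ℕ) (T : Table) (b : ℕ) (K : Finset ℕ) (hb : l.length ≤ b)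
    (hK : ∀ x ∈ l, x ∈ K) :
    wp G ident (.look l T) (fun b' K' T' => b' = b - l.length ∧ K ⊆ K' ∧
      ∀ u, u ∈ l ∨ T.CorrectAt G ident u → T'.CorrectAt G ident u) b K := by
  induction l generalizing T b K with
  | nil => exact ⟨rfl, subset_rfl, fun u hu => by simpa using hu⟩
  | cons w l ih =>
    rw [List.length_cons] at hb
    refine ⟨hK w (by simp), by omega, wp_mono (ih _ (b - 1) _ (by omega) fun x hx =>
      Finset.mem_union_left _ (Finset.mem_union_left _ (hK x (by simp [hx])))) ?_⟩
    rintro b' K' T' ⟨h1, h2, h3⟩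
    refine ⟨by rw [List.length_cons]; omega, fun x hx => h2
      (Finset.mem_union_left _ (Finset.mem_union_left _ hx)), fun u hu => h3 u ?_⟩
    rcases hu with hu | hu
    · rcases List.mem_cons.1 hu with rfl | hu
      · exact .inr (T.correctAt_update u)
      · exact .inl hu
    · exact .inr (hu.update w)

theorem mem_parents_iff {w x : V} : w ∈ parents G x ↔ x ∈ children G w := by
  simp [parents, children]

theorem tableWeight_spec (h0 : 0 < α) (h1 : α < 1)
    (hT : ∀ u ∈ Q, T.CorrectAt G ident (ident u)) :
    (∀ u ∉ Q.map ident, tableWeight α (ident v) (Q.map ident) T u = 0) ∧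
      IsCoreWeight α G v Q fun x => tableWeight α (ident v) (Q.map ident) T (ident x) := by
  classical
  have hex : ∃ e : ℕ → ℝ, ∀ u, e u = if u ∈ Q.map ident then (if u = ident v then 1 else 0) +
      α * (((T u).2.card : ℝ)⁻¹ * ∑ x ∈ (T u).2, e x) else 0 := by
    obtain ⟨e, he⟩ := exists_isCoreWeight h0 h1 (G := G) v Q
    refine ⟨Function.extend ident e 0, fun u => ?_⟩
    by_cases hu : u ∈ Q.map ident
    · rw [if_pos hu]
      obtain ⟨x, hx, rfl⟩ := Finset.mem_map.1 hu
      rw [hT x hx, childIds_ident, ident.injective.extend_apply, he x, if_pos hx, sum_follow_mul]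
      simp [ident.injective.extend_apply]
    · rw [if_neg hu]
      by_cases h : ∃ x, ident x = u
      · obtain ⟨x, rfl⟩ := h
        rw [ident.injective.extend_apply, he x, if_neg fun h => hu (Finset.mem_map_of_mem _ h)]
      · rw [Function.extend_apply' _ _ _ h]; rfl
  have hs := Classical.epsilon_spec hex
  change ∀ u, tableWeight α (ident v) (Q.map ident) T u = _ at hs
  refine ⟨fun u hu => by rw [hs u, if_neg hu], fun u => ?_⟩
  beta_reduce
  rw [hs (ident u)]
  by_cases hu : u ∈ Q
  · rw [if_pos (Finset.mem_map_of_mem _ hu), if_pos hu, hT u hu, childIds_ident, sum_follow_mul]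
    simp only [ident.injective.eq_iff, Finset.card_map, Finset.sum_map]
    rfl
  · rw [if_neg hu, if_neg fun h => hu ((Finset.mem_map' _).1 h)]

/-- Weights vanish outside `Q`, and the children of `w` in `Q` are visible in the parent lists
recorded at `Q`. The numerator is therefore exact although `w` need not have been queried; only its
number of children is replaced by an estimate. -/
theorem tableBound_eq (h0 : 0 < α) (h1 : α < 1) (hT : ∀ u ∈ Q, T.CorrectAt G ident (ident u))
    {e : V → ℝ} (he : IsCoreWeight α G v Q e) (w : V) :
    tableBound α (ident v) d (Q.map ident) T (ident w) =
      α * (∑ x ∈ children G w, e x) / d (ident w) := by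
  classical
  obtain ⟨-, h2⟩ := tableWeight_spec (v := v) h0 h1 hT
  have h3 := fun x => congrFun (h2.unique h0 h1 he) x
  unfold tableBound
  congr 2
  rw [Finset.sum_filter, Finset.sum_map, ← Finset.sum_subset
    (Finset.inter_subset_left : children G w ∩ Q ⊆ children G w), Finset.inter_comm,
    ← Finset.filter_mem_eq_inter, Finset.sum_filter]
  · refine Finset.sum_congr rfl fun x hx => ?_
    rw [hT x hx, parentIds_ident]
    simp only [Finset.mem_map', mem_parents_iff, h3]
  · intro x hx hx'
    rw [he x, if_neg fun h => hx' (Finset.mem_inter.2 ⟨hx, h⟩)]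

/-- All the estimated residuals outside the core are at most `θ`. -/
def GoodCore (α : ℝ) (G : Digraph V) (v : V) (d : V → ℕ) (Q : Finset V) (θ : ℝ) : Prop :=
  ∀ e, IsCoreWeight α G v Q e → ∀ w ∉ Q, α * (∑ x ∈ children G w, e x) / d w ≤ θ

theorem mem_frontier_iff (hT : ∀ u ∈ Q, T.CorrectAt G ident (ident u)) {y : ℕ} :
    y ∈ frontier (Q.map ident) T ↔ ∃ w ∉ Q, (∃ x ∈ Q, x ∈ children G w) ∧ ident w = y := by
  simp only [frontier, Finset.mem_sdiff, Finset.mem_biUnion, Finset.mem_map,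
    exists_exists_and_eq_and]
  constructor
  · rintro ⟨⟨x, hx, hy⟩, hQ⟩
    rw [hT x hx, parentIds_ident, Finset.mem_map] at hy
    obtain ⟨w, hw, rfl⟩ := hy
    exact ⟨w, fun h => hQ ⟨w, h, rfl⟩, ⟨x, hx, mem_parents_iff.1 hw⟩, rfl⟩
  · rintro ⟨w, hw, ⟨x, hx, hxw⟩, rfl⟩
    refine ⟨⟨x, hx, ?_⟩, ?_⟩
    · rw [hT x hx, parentIds_ident]
      exact Finset.mem_map_of_mem _ (mem_parents_iff.2 hxw)
    · rintro ⟨a, ha, h⟩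
      exact hw (ident.injective h ▸ ha)

/-- A node without a child in `Q` has residual zero, so only the frontier matters. -/
theorem goodCore_iff (h0 : 0 < α) (h1 : α < 1) (hT : ∀ u ∈ Q, T.CorrectAt G ident (ident u))
    {θ : ℝ} (hθ : 0 ≤ θ) :
    GoodCore α G v (fun w => d (ident w)) Q θ ↔ maxBound α (ident v) d (Q.map ident) T ≤ θ := by
  constructor
  · intro h
    unfold maxBound
    split_ifs with hf
    · obtain ⟨w, hw, -, hw'⟩ := (mem_frontier_iff hT).1
        (Finset.exists_max_image _ (tableBound α (ident v) d (Q.map ident) T) hf).choose_spec.1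
      change ident w = nextNode α (ident v) d (Q.map ident) T hf at hw'
      obtain ⟨e, he⟩ := exists_isCoreWeight h0 h1 (G := G) v Q
      rw [← hw', tableBound_eq h0 h1 hT he]
      exact h e he w hw
    · exact hθ
  · intro h e he w hw
    by_cases hx : ∃ x ∈ Q, x ∈ children G w
    · have hf := (mem_frontier_iff hT).2 ⟨w, hw, hx, rfl⟩
      rw [maxBound, dif_pos ⟨_, hf⟩] at h
      rw [← tableBound_eq h0 h1 hT he]
      exact ((Finset.exists_max_image _ (tableBound α (ident v) d (Q.map ident) T)
        ⟨_, hf⟩).choose_spec.2 _ hf).trans h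
    · push Not at hx
      have : ∑ x ∈ children G w, e x = 0 := Finset.sum_eq_zero fun x hxw => by
        rw [he x, if_neg fun h => hx x h hxw]
      rw [this]
      simpa using hθ

/-- `d` underestimates the numbers of children by a factor of at most `D`. -/
def DegreeEstimate (G : Digraph V) (d : V → ℕ) (D : ℝ) : Prop :=
  ∀ w, 1 ≤ d w ∧ d w ≤ max 1 (children G w).card ∧ ((children G w).card : ℝ) ≤ D * d w

theorem residual_eq (e : V → ℝ) (w : V) :
    residual α G e w = α * (∑ x ∈ children G w, e x) / (children G w).card := by
  rw [residual, sum_follow_mul]; ring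

theorem residual_le_bound (h0 : 0 < α) {d : V → ℕ} {D : ℝ} (hd : DegreeEstimate G d D)
    {e : V → ℝ} (he : ∀ x, 0 ≤ e x) (w : V) :
    residual α G e w ≤ α * (∑ x ∈ children G w, e x) / d w := by
  have hs : 0 ≤ α * ∑ x ∈ children G w, e x :=
    mul_nonneg h0.le (Finset.sum_nonneg fun x _ => he x)
  obtain ⟨d1, d2, -⟩ := hd w
  rw [residual_eq]
  rcases Nat.eq_zero_or_pos (children G w).card with hc | hc
  · rw [hc]; simp only [Nat.cast_zero, div_zero]; positivity
  · rw [max_eq_right hc] at d2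
    exact div_le_div_of_nonneg_left hs (by exact_mod_cast d1) (by exact_mod_cast d2)

theorem bound_le_residual (h0 : 0 < α) {d : V → ℕ} {D : ℝ}
    (hd : DegreeEstimate G d D) {e : V → ℝ} (he : ∀ x, 0 ≤ e x) (w : V) :
    α * (∑ x ∈ children G w, e x) / d w / D ≤ residual α G e w := by
  have hs : 0 ≤ α * ∑ x ∈ children G w, e x :=
    mul_nonneg h0.le (Finset.sum_nonneg fun x _ => he x)
  obtain ⟨d1, -, d3⟩ := hd w
  rw [residual_eq]
  rcases Nat.eq_zero_or_pos (children G w).card with hc | hc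
  · rw [Finset.card_eq_zero.1 hc]; simp
  · rw [div_div, mul_comm (d w : ℝ)]
    exact div_le_div_of_nonneg_left hs (by exact_mod_cast hc) d3

/-- Invariant: either some subset of the core is already good, or every node other than `v` has
weight at least `θ / D`. If the current core is not good, the chosen node has estimated residual
above `θ`, hence true residual at least `θ / D`, and its weight after insertion is at least that;
old weights do not decrease. Choosing the maximum makes the exploration independent of `θ`. -/
theorem wp_explore (h0 : 0 < α) (h1 : α < 1) {D : ℝ} (hD : 0 < D)
    (hd : DegreeEstimate G (fun w => d (ident w)) D) {θ : ℝ} (hθ : 0 ≤ θ) (j b : ℕ)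
    (K : Finset ℕ) (Q : Finset V) (T : Table) (hv : v ∈ Q)
    (hT : ∀ u ∈ Q, T.CorrectAt G ident (ident u)) (hb : j ≤ b)
    (hK : ∀ u ∈ Q, parentIds G ident (ident u) ⊆ K)
    (hQ : (∃ Q' ⊆ Q, v ∈ Q' ∧ GoodCore α G v (fun w => d (ident w)) Q' θ) ∨
      ∀ e, IsCoreWeight α G v Q e → ∀ u ∈ Q, u ≠ v → θ / D ≤ e u) :
    wp G ident (.explore α (ident v) d j (Q.map ident) T) (fun b' K' R => b - j ≤ b' ∧ K ⊆ K' ∧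
      ∃ Q' : Finset V, R.1 = Q'.map ident ∧ v ∈ Q' ∧
        (∀ u ∈ Q', R.2.CorrectAt G ident (ident u)) ∧
        ((∃ Q'' ⊆ Q', v ∈ Q'' ∧ GoodCore α G v (fun w => d (ident w)) Q'' θ) ∨
          (Q.card + j ≤ Q'.card ∧
            ∀ e, IsCoreWeight α G v Q' e → ∀ u ∈ Q', u ≠ v → θ / D ≤ e u))) b K := by
  classical
  induction j generalizing b K Q T with
  | zero => exact ⟨le_rfl, subset_rfl, Q, rfl, hv, hT, hQ.imp id fun h => ⟨le_rfl, h⟩⟩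
  | succ j ih =>
    unfold Prog.explore
    split_ifs with hf
    · have hmem := (Finset.exists_max_image _
        (tableBound α (ident v) d (Q.map ident) T) hf).choose_spec.1
      change nextNode α (ident v) d (Q.map ident) T hf ∈ _ at hmem
      obtain ⟨w, hw, ⟨x, hx, hxw⟩, hw'⟩ := (mem_frontier_iff hT).1 hmem
      have hmax : maxBound α (ident v) d (Q.map ident) T =
          tableBound α (ident v) d (Q.map ident) T (ident w) := by
        rw [maxBound, dif_pos hf, hw']
      rw [← hw']
      have hins : insert (ident w) (Q.map ident) = (insert w Q).map ident := by
        rw [Finset.map_insert]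
      refine ⟨hK x hx ?_, by omega, ?_⟩
      · rw [parentIds_ident]
        exact Finset.mem_map_of_mem _ (mem_parents_iff.2 hxw)
      rw [hins]
      refine wp_mono (ih (b - 1) _ (insert w Q) _ (Finset.mem_insert_of_mem hv) ?_ (by omega)
        ?_ ?_) ?_
      · intro u hu
        rcases Finset.mem_insert.1 hu with rfl | hu
        · exact T.correctAt_update _
        · exact (hT u hu).update _
      · intro u hu
        rcases Finset.mem_insert.1 hu with rfl | hu
        · exact fun y hy => Finset.mem_union_left _ (Finset.mem_union_right _ hy)
        · exact fun y hy => Finset.mem_union_left _ (Finset.mem_union_left _ (hK u hu hy))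
      · by_cases hg : ∃ Q' ⊆ Q, v ∈ Q' ∧ GoodCore α G v (fun w => d (ident w)) Q' θ
        · obtain ⟨Q', h2, h3⟩ := hg
          exact .inl ⟨Q', h2.trans (Finset.subset_insert _ _), h3⟩
        · right
          have hQ' := hQ.resolve_left hg
          have hng : ¬ GoodCore α G v (fun w => d (ident w)) Q θ :=
            fun h => hg ⟨Q, subset_rfl, hv, h⟩
          rw [goodCore_iff h0 h1 hT hθ, not_le, hmax] at hng
          obtain ⟨e, he⟩ := exists_isCoreWeight h0 h1 (G := G) v Q
          rw [tableBound_eq h0 h1 hT he] at hng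
          intro e' he' u hu huv
          rcases Finset.mem_insert.1 hu with rfl | hu'
          · refine le_trans ?_ (he.residual_le h0 h1 he' (Finset.subset_insert _ _) hu)
            exact (div_le_div_of_nonneg_right hng.le hD.le).trans
              (bound_le_residual h0 hd (he.nonneg h0 h1) u)
          · exact (hQ' e he u hu' huv).trans
              (he.mono h0 h1 he' (Finset.subset_insert _ _) (he'.nonneg h0 h1) u)
      · rintro b' K' R ⟨h1, h2, Q', h3, h4, h5, h6⟩
        refine ⟨by omega, fun y hy => h2
          (Finset.mem_union_left _ (Finset.mem_union_left _ hy)), Q', h3, h4, h5, h6.imp id ?_⟩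
        rintro ⟨h7, h8⟩
        rw [Finset.card_insert_of_notMem hw] at h7
        exact ⟨by omega, h8⟩
    · refine ⟨by omega, subset_rfl, Q, rfl, hv, hT, .inl ⟨Q, subset_rfl, hv, ?_⟩⟩
      rw [goodCore_iff h0 h1 hT hθ, maxBound, dif_neg hf]
      exact hθ

/-- Cores with large weights are small. -/
theorem card_mul_le (h0 : 0 < α) (h1 : α < 1) {e : V → ℝ} (he : IsCoreWeight α G v Q e)
    (hv : v ∈ Q) {t : ℝ} (hu : ∀ u ∈ Q, u ≠ v → t ≤ e u) :
    (Q.card - 1 : ℝ) * t ≤ Fintype.card V * (pageRank α G v / (1 - α)) := by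
  classical
  have : Nonempty V := ⟨v⟩
  have hV : (0 : ℝ) < Fintype.card V := by exact_mod_cast Fintype.card_pos
  have h2 := avg_coreWeight_le h0 h1 he hv
  rw [avg, inv_mul_le_iff₀ hV] at h2
  refine le_trans ?_ h2
  have h3 : ((Q.erase v).card : ℝ) * t ≤ ∑ u ∈ Q.erase v, e u := by
    rw [← nsmul_eq_mul]
    exact Finset.card_nsmul_le_sum _ _ _ fun u hu' =>
      hu u (Finset.mem_of_mem_erase hu') (Finset.ne_of_mem_erase hu')
  rw [Finset.card_erase_of_mem hv, Nat.cast_sub (Finset.card_pos.2 ⟨v, hv⟩), Nat.cast_one] at h3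
  exact h3.trans (Finset.sum_le_sum_of_subset_of_nonneg (Finset.subset_univ _)
    fun x _ _ => he.nonneg h0 h1 x)

/-- The threshold `θ` used later involves the unknown `P(v)`. Minimising over all subsets containing
`v` attains every threshold that some such subset attains. -/
theorem bestCore_spec (h0 : 0 < α) (h1 : α < 1) (hT : ∀ u ∈ Q, T.CorrectAt G ident (ident u))
    {θ : ℝ} (hθ : 0 ≤ θ)
    (h : ∃ Q' ⊆ Q, v ∈ Q' ∧ GoodCore α G v (fun w => d (ident w)) Q' θ) :
    ∃ Q' ⊆ Q, v ∈ Q' ∧ GoodCore α G v (fun w => d (ident w)) Q' θ ∧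
      bestCore α (ident v) d (Q.map ident) T = Q'.map ident := by
  classical
  obtain ⟨Q', h2, h3, h4⟩ := h
  have hmem : Q'.map ident ∈ (Q.map ident).powerset.filter fun R => ident v ∈ R :=
    Finset.mem_filter.2 ⟨Finset.mem_powerset.2 (Finset.map_subset_map.2 h2),
      Finset.mem_map_of_mem _ h3⟩
  rw [bestCore, dif_pos ⟨_, hmem⟩]
  generalize_proofs hp
  obtain ⟨h5, h6⟩ := hp.choose_spec
  obtain ⟨h7, h8⟩ := Finset.mem_filter.1 h5
  obtain ⟨B, hB, hB'⟩ := Finset.subset_map_iff.1 (Finset.mem_powerset.1 h7)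
  rw [hB'] at h6 h8
  refine ⟨B, hB, (Finset.mem_map' _).1 h8, ?_, hB'⟩
  rw [goodCore_iff h0 h1 (fun u hu => hT u (hB hu)) hθ]
  exact (h6 _ hmem).trans ((goodCore_iff h0 h1 (fun u hu => hT u (h2 hu)) hθ).1 h4)

end explore

theorem le_drawExp_of_bad {V : Type*} [Fintype V] [Nonempty V] {m : ℕ} {X : List V → ℝ}
    {c δ₁ δ₂ : ℝ} (B₁ B₂ : List V → Prop) [DecidablePred B₁] [DecidablePred B₂]
    (h₁ : drawExp m [] (fun L => if B₁ L then 1 else 0) ≤ δ₁)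
    (h₂ : drawExp m [] (fun L => if B₂ L then 1 else 0) ≤ δ₂)
    (hc : c ≤ 1) (hX : ∀ L, 0 ≤ X L)
    (h : ∀ L, L.length = m → ¬ B₁ L → ¬ B₂ L → c ≤ X L) : c - δ₁ - δ₂ ≤ drawExp m [] X := by
  have key : drawExp m ([] : List V) (fun _ => c) ≤ drawExp m ([] : List V) (fun L =>
      X L + ((if B₁ L then 1 else 0) + if B₂ L then 1 else 0)) := by
    refine drawExp_mono _ _ fun L hL => ?_
    have := hX L
    by_cases h1 : B₁ L
    · rw [if_pos h1]; split_ifs <;> linarith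
    by_cases h2 : B₂ L
    · rw [if_pos h2]; split_ifs; linarith
    · rw [if_neg h1, if_neg h2]
      linarith [h L (by simpa using hL) h1 h2]
  rw [drawExp_const, drawExp_add, drawExp_add] at key
  linarith

/-! ### Estimating numbers of children from sampled nodes -/

/-- Lower estimate of the number of children of `w`: the number of its children in a sample. -/
def sampleDegree (l : List ℕ) (T : Table) (w : ℕ) : ℕ :=
  max 1 (l.toFinset.filter fun u => w ∈ (T u).1).card

section sampleDegree
variable {V : Type*} [Fintype V] {G : Digraph V} {ident : V ↪ ℕ} {T : Table}

open Classical in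
theorem sampleDegree_eq (L : List V)
    (hT : ∀ u ∈ L.map ident, T.CorrectAt G ident u) (w : V) :
    sampleDegree (L.map ident) T (ident w) = max 1 (L.toFinset ∩ children G w).card := by
  unfold sampleDegree
  congr 1
  rw [← Finset.card_map ident]
  congr 1
  ext u
  simp only [Finset.mem_filter, List.mem_toFinset, Finset.mem_map, Finset.mem_inter]
  constructor
  · rintro ⟨h1, h2⟩
    rw [hT u h1] at h2
    obtain ⟨x, hx, rfl⟩ := List.mem_map.1 h1
    rw [parentIds_ident, Finset.mem_map' ident, mem_parents_iff] at h2
    exact ⟨x, ⟨hx, h2⟩, rfl⟩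
  · rintro ⟨x, ⟨hx, h2⟩, rfl⟩
    have h1 : ident x ∈ L.map ident := List.mem_map_of_mem hx
    refine ⟨h1, ?_⟩
    rw [hT _ h1, parentIds_ident]
    exact Finset.mem_map_of_mem _ (mem_parents_iff.2 h2)

open Classical in
theorem degreeEstimate_sampleDegree (L : List V) (hT : ∀ u ∈ L.map ident, T.CorrectAt G ident u)
    {D : ℝ} (hD : ∀ w, ((children G w).card : ℝ) ≤
      D * (max 1 (L.toFinset ∩ children G w).card : ℕ)) :
    DegreeEstimate G (fun w => sampleDegree (L.map ident) T (ident w)) D := by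
  intro w
  beta_reduce
  rw [sampleDegree_eq L hT]
  exact ⟨le_max_left _ _, max_le_max le_rfl (Finset.card_le_card Finset.inter_subset_right), hD w⟩

open Classical in
-- A trivial factor valid for every sample, for the query count, which must hold even on unlucky
-- runs.
theorem degreeEstimate_card (L : List V) (hT : ∀ u ∈ L.map ident, T.CorrectAt G ident u) :
    DegreeEstimate G (fun w => sampleDegree (L.map ident) T (ident w)) (Fintype.card V) := by
  refine degreeEstimate_sampleDegree L hT fun w => ?_
  have h1 : ((children G w).card : ℝ) ≤ Fintype.card V := by exact_mod_cast Finset.card_le_univ _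
  have h2 : (1 : ℝ) ≤ (max 1 (L.toFinset ∩ children G w).card : ℕ) := by
    exact_mod_cast le_max_left _ _
  exact h1.trans (le_mul_of_one_le_right (by positivity) h2)

open Classical in
/-- A set consisting of `k` disjoint blocks of size `D` is hit by the sample in at least `k`
points, unless some block is missed. -/
theorem drawExp_inter_lt [Nonempty V] (m D k : ℕ) (C : Finset V) (hk : k * D ≤ C.card) :
    drawExp m ([] : List V) (fun L => if (L.toFinset ∩ C).card < k then 1 else 0) ≤
      k * Real.exp (-(m * (D / Fintype.card V))) := by
  induction k generalizing C with
  | zero => simp [drawExp_const]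
  | succ k ih =>
    have hD : D ≤ C.card := le_trans (Nat.le_mul_of_pos_left _ (Nat.succ_pos k)) hk
    obtain ⟨B, hB, rfl⟩ := Finset.exists_subset_card_eq hD
    have hc := Finset.card_sdiff_add_card_eq_card hB
    have h1 := ih (C \ B) (by rw [Nat.succ_mul] at hk; omega)
    have h2 := drawExp_miss B m ([] : List V)
    have h3 : drawExp m ([] : List V) (fun L => if (L.toFinset ∩ C).card < k + 1 then 1 else 0) ≤
        drawExp m ([] : List V) (fun L => (if (L.toFinset ∩ (C \ B)).card < k then (1 : ℝ) else 0) +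
          if ∀ x ∈ L, x ∉ B then 1 else 0) := by
      refine drawExp_mono _ _ fun L _ => ?_
      by_cases hL : ∀ x ∈ L, x ∉ B
      · rw [if_pos hL]
        split_ifs <;> norm_num
      · rw [if_neg hL]
        push Not at hL
        obtain ⟨x, hx, hxB⟩ := hL
        have : (L.toFinset ∩ (C \ B)).card + 1 ≤ (L.toFinset ∩ C).card := by
          rw [← Finset.card_insert_of_notMem (a := x) (s := L.toFinset ∩ (C \ B)) (by simp [hxB])]
          refine Finset.card_le_card fun y hy => ?_
          rcases Finset.mem_insert.1 hy with rfl | hy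
          · exact Finset.mem_inter.2 ⟨List.mem_toFinset.2 hx, hB hxB⟩
          · exact Finset.inter_subset_inter_left Finset.sdiff_subset hy
        split_ifs <;> first | (exfalso; omega) | norm_num
    rw [drawExp_add] at h3
    push_cast
    linarith

open Classical in
-- Use `⌊c / D⌋` blocks, at most `n`, for a node with `c` children, and a union bound over the
-- nodes. The factor 2 covers the rounding and the case of no hit.
theorem drawExp_degree [Nonempty V] (G : Digraph V) (m : ℕ) {D : ℕ} (hD : 0 < D) :
    drawExp m ([] : List V) (fun L => if ∃ w, 2 * (D : ℝ) *
        (max 1 (L.toFinset ∩ children G w).card : ℕ) < (children G w).card then 1 else 0) ≤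
      (Fintype.card V : ℝ) ^ 2 * Real.exp (-(m * (D / Fintype.card V))) := by
  calc _ ≤ drawExp m ([] : List V) (fun L => ∑ w, if (L.toFinset ∩ children G w).card <
          (children G w).card / D then (1 : ℝ) else 0) := by
        refine drawExp_mono _ _ fun L _ => ?_
        split_ifs with h
        · obtain ⟨w, hw⟩ := h
          have h2 : (L.toFinset ∩ children G w).card < (children G w).card / D := by
            by_contra h3
            rw [not_lt] at h3
            have h4 : 2 * D * max 1 (L.toFinset ∩ children G w).card < (children G w).card := by
              exact_mod_cast hw
            have h5 := Nat.lt_mul_div_succ (children G w).card hD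
            have h6 : (children G w).card / D + 1 ≤
                2 * max 1 (L.toFinset ∩ children G w).card := by
              have := le_max_left 1 (L.toFinset ∩ children G w).card
              have := le_max_right 1 (L.toFinset ∩ children G w).card
              omega
            have h7 := Nat.mul_le_mul_left D h6
            rw [← mul_assoc, mul_comm D 2] at h7
            omega
          refine le_trans ?_ (Finset.single_le_sum (fun w _ => ?_) (Finset.mem_univ w))
          · rw [if_pos h2]
          · split_ifs <;> norm_num
        · exact Finset.sum_nonneg fun w _ => by split_ifs <;> norm_num
    _ = ∑ w : V, drawExp m ([] : List V) (fun L => if (L.toFinset ∩ children G w).card <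
          (children G w).card / D then (1 : ℝ) else 0) := drawExp_sum _ _ _ _
    _ ≤ ∑ _w : V, (Fintype.card V : ℝ) * Real.exp (-(m * (D / Fintype.card V))) := by
        refine Finset.sum_le_sum fun w _ => (drawExp_inter_lt m D _ _
          (Nat.div_mul_le_self _ _)).trans (mul_le_mul_of_nonneg_right ?_ (Real.exp_pos _).le)
        exact_mod_cast (Nat.div_le_self _ _).trans (Finset.card_le_univ _)
    _ = _ := by simp; ring

end sampleDegree

/-! ### The two final phases -/

/-- Estimate the PageRank of `v` by exploring a core around it and letting the random surfer run. -/
def Prog.estimate (α : NNReal) (hα : α ≤ 1) (m v : ℕ) : Prog ℝ :=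
  (Prog.draw m []).bind fun l =>
  (Prog.look l fun _ => (∅, ∅)).bind fun T =>
  .nbr v fun A B =>
  (Prog.explore α v (sampleDegree l T) m {v} (Function.update T v (A, B))).bind fun R =>
  .rand fun x =>
  (Prog.surf α hα (fun y C =>
    (if y ∈ bestCore α v (sampleDegree l T) R.1 R.2 then 0 else α * ((C.card : ℝ)⁻¹ * ∑ z ∈ C,
      tableWeight α v (bestCore α v (sampleDegree l T) R.1 R.2) R.2 z),
    (1 - α) + α * if C = ∅ then 1 else 0)) m 0 x).bind fun s =>
  .ret ((s.1 + (∑ u ∈ bestCore α v (sampleDegree l T) R.1 R.2,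
    tableWeight α v (bestCore α v (sampleDegree l T) R.1 R.2) R.2 u) *
      (2 * collisions l / (m * (m - 1))) * s.2) / m)

section estimate
variable {V : Type*} [Fintype V] [Nonempty V] {G : Digraph V} {ident : V ↪ ℕ}

/-- The count is `m` samples, `m` lookups, one query of `v`, at most `m` explorations, one start
node and two queries for each of the `m` surfer steps. -/
theorem wp_estimate (α : NNReal) (h0 : 0 < α) (h1 : α < 1) (m : ℕ) (v : V) (b : ℕ)
    (K : Finset ℕ) (hb : 5 * m + 2 ≤ b) (hv : ident v ∈ K) :
    wp G ident (.estimate α h1.le m (ident v)) (fun _ _ _ => True) b K := by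
  refine wp_bind (wp_mono (wp_draw m b K [] (by omega) (by simp)) ?_)
  rintro b₁ K₁ _ ⟨rfl, hK₁, hl, L, rfl, hL⟩
  rw [List.length_nil, zero_add] at hL
  refine wp_bind (wp_mono (wp_look _ _ _ K₁ (by rw [List.length_map]; omega) hl) ?_)
  rintro b₂ K₂ T ⟨rfl, hK₂, hT⟩
  refine ⟨hK₂ (hK₁ hv), by rw [List.length_map]; omega, ?_⟩
  have hV : (0 : ℝ) < Fintype.card V := by exact_mod_cast Fintype.card_pos
  have hT' : ∀ u ∈ L.map ident, T.CorrectAt G ident u := fun u hu => hT u (.inl hu)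
  -- Only the query count is wanted here, so `θ = 0` and the trivial degree factor suffice.
  have := wp_explore (G := G) (ident := ident) (α := α) (v := v)
    (d := sampleDegree (L.map ident) T) (by exact_mod_cast h0) (by exact_mod_cast h1) hV
    (degreeEstimate_card L hT') le_rfl m (b - m - (L.map ident).length - 1)
    (K₂ ∪ parentIds G ident (ident v) ∪ childIds G ident (ident v)) {v}
    (Function.update T (ident v) (parentIds G ident (ident v), childIds G ident (ident v)))
    (Finset.mem_singleton_self v) (fun u hu => by
      rw [Finset.mem_singleton.1 hu]; exact T.correctAt_update _)
    (by rw [List.length_map]; omega) (fun u hu => by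
      rw [Finset.mem_singleton.1 hu]
      exact fun y hy => Finset.mem_union_left _ (Finset.mem_union_right _ hy))
    (.inr fun e _ u hu huv => absurd (Finset.mem_singleton.1 hu) huv)
  rw [Finset.map_singleton] at this
  refine wp_bind (wp_mono this ?_)
  rintro b₃ K₃ R ⟨hb₃, -, -⟩
  rw [List.length_map, hL] at hb₃
  refine ⟨by omega, fun x => wp_bind (wp_mono (wp_surf α h1.le _ m 0 x _ _ (by omega)
    (Finset.mem_insert_self _ _) (P := fun _ => True) (fun _ _ _ _ => trivial) trivial)
    fun _ _ _ _ => trivial)⟩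

open Classical in
/-- The random surfer phase. -/
theorem le_expect_surf {α : NNReal} (h0 : (0 : ℝ) < α) (h1 : (α : ℝ) < 1) {v : V}
    {Q : Finset V} (hv : v ∈ Q) {T : Table} (hT : ∀ u ∈ Q, T.CorrectAt G ident (ident u))
    {θ ε κ A : ℝ} (hε0 : 0 < ε) (hε1 : ε < 1) (hθ : 0 ≤ θ)
    (hr : ∀ e, IsCoreWeight α G v Q e → ∀ w ∉ Q, residual α G e w ≤ θ)
    (hκ : |κ * Fintype.card V - 1| ≤ ε / 3) {m : ℕ} (hm : 0 < m)
    (hA : (θ + pageRank α G v / (1 - α)) / (1 - α) ≤ pageRank α G v * A)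
    (hAm : 432 * A ≤ ε ^ 3 * m) (hα : α ≤ 1) (x : V) :
    1 - ε / 4 ≤ expect G ident ((Prog.surf α hα (fun y C =>
      (if y ∈ Q.map ident then 0 else α * ((C.card : ℝ)⁻¹ * ∑ z ∈ C,
        tableWeight α (ident v) (Q.map ident) T z),
      (1 - α) + α * if C = ∅ then 1 else 0)) m 0 (ident x)).bind fun s =>
        .ret ((s.1 + (∑ u ∈ Q.map ident, tableWeight α (ident v) (Q.map ident) T u) * κ * s.2) / m))
      (Set.indicator {y | (1 - ε) * pageRank α G v ≤ y ∧ y ≤ (1 + ε) * pageRank α G v} 1) := by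
  obtain ⟨hz, he⟩ := tableWeight_spec (v := v) h0 h1 hT
  set e : V → ℝ := fun x => tableWeight α (ident v) (Q.map ident) T (ident x) with he_def
  set p := pageRank α G v with hp_def
  have hp : 0 < p := pageRank_pos h0 h1 v
  have hnn := he.nonneg h0 h1
  have hV : (0 : ℝ) < Fintype.card V := by exact_mod_cast Fintype.card_pos
  have hE : ∑ u ∈ Q.map ident, tableWeight α (ident v) (Q.map ident) T u =
      avg e * Fintype.card V := by
    rw [Finset.sum_map, avg, ← Finset.sum_subset (Finset.subset_univ Q) fun u _ hu => by
      rw [he u, if_neg hu]]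
    field_simp
    rfl
  set F : ℕ → Finset ℕ → ℝ × ℝ := fun y C =>
      (if y ∈ Q.map ident then 0 else α * ((C.card : ℝ)⁻¹ * ∑ z ∈ C,
        tableWeight α (ident v) (Q.map ident) T z),
      (1 - α) + α * if C = ∅ then 1 else 0) with hF
  set f : V → ℝ × ℝ := fun x => F (ident x) ((children G x).map ident) with hf
  have hfe : ∀ w, (f w).1 + avg e * (f w).2 = coreEstimate α G Q e w := by
    intro w
    simp only [hf, hF, coreEstimate, residual, sum_follow_mul, Finset.mem_map', Finset.card_map,
      Finset.sum_map, Finset.map_eq_empty, he_def]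
  have hmR : (0 : ℝ) < m := by exact_mod_cast hm
  have h1' : (0 : ℝ) < 1 - α := sub_pos.2 h1
  have hA0 : 0 < A := by
    have : 0 < (θ + p / (1 - α)) / (1 - α) := by positivity
    exact (mul_pos_iff_of_pos_left hp).1 (this.trans_le hA)
  obtain ⟨h, hh⟩ := exists_potential h0 h1 (transition_nonneg G)
    (fun i => (transition_row_sum G i).le) (coreEstimate α G Q e)
  have hhp : p = (1 - α) * avg h := by
    rw [← sum_pageRank_mul_potential h0 h1 hh, sum_pageRank_mul_coreEstimate h0 h1 he hv]
  have hhA : ∀ x, h x ≤ p * A := fun x => (potential_le h0 h1 (transition_nonneg G)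
    (fun i => (transition_row_sum G i).le) hh (by positivity)
    (coreEstimate_le h0 h1 he hv hθ (hr e he)) x).trans hA
  have hsq := surfExp_sq_le h0 h1 f (avg e) (fun x => by
    rw [hfe]; exact coreEstimate_nonneg h0 h1 hnn x) (fun x => by rw [hfe]; exact hh x) hhp hhA m x
  have hd : 0 < m * p * (ε / 3) := by positivity
  have hch := surfExp_chebyshev (G := G) h0 h1 f m 0 x (fun z => z.1 + avg e * z.2 - m * p) hd
    (fun z => m * p * (ε / 3) ≤ |z.1 + avg e * z.2 - m * p|) fun z hz => hz
  have hbad : surfExp α G f m 0 x (fun z => if m * p * (ε / 3) ≤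
      |z.1 + avg e * z.2 - m * p| then (1 : ℝ) else 0) ≤ ε / 4 := by
    -- With `H = p * A`, the hypothesis `432 * A ≤ ε ^ 3 * m` bounds `6 * A * m` by half of `ε ^ 3 *
    -- m ^ 2 / 36`, and `A ≤ m / 432` makes `4 * A ^ 2` much smaller.
    refine hch.trans ((div_le_div_of_nonneg_right hsq (by positivity)).trans ?_)
    rw [div_le_iff₀ (by positivity)]
    have e1 : ε / 4 * (m * p * (ε / 3)) ^ 2 = p ^ 2 * (ε ^ 3 * m * m / 36) := by ring
    have e2 : 6 * (p * A) * p * m + 4 * (p * A) ^ 2 = p ^ 2 * (6 * A * m + 4 * A ^ 2) := by ring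
    rw [e1, e2]
    refine mul_le_mul_of_nonneg_left ?_ (sq_nonneg p)
    have e3 : ε ^ 3 * m ≤ m := mul_le_of_le_one_left hmR.le (pow_le_one₀ hε0.le hε1.le)
    have e4 := mul_le_mul_of_nonneg_right hAm hmR.le
    have e5 : 432 * A ≤ m := hAm.trans e3
    have e6 : A * (432 * A) ≤ A * m := mul_le_mul_of_nonneg_left e5 hA0.le
    nlinarith
  have hwn : ∀ u, 0 ≤ tableWeight α (ident v) (Q.map ident) T u := by
    intro u
    by_cases hu : u ∈ Q.map ident
    · obtain ⟨y, -, rfl⟩ := Finset.mem_map.1 hu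
      exact hnn y
    · rw [hz u hu]
  have hF0 : ∀ y C, 0 ≤ (F y C).1 ∧ 0 ≤ (F y C).2 := by
    intro y C
    rw [hF]
    dsimp only
    refine ⟨?_, ?_⟩
    · split_ifs
      · exact le_rfl
      · exact mul_nonneg h0.le (mul_nonneg (inv_nonneg.2 (Nat.cast_nonneg _))
          (Finset.sum_nonneg fun z _ => hwn z))
    · split_ifs <;> linarith
  rw [expect_bind]
  simp only [expect]
  rw [← expect_surf α hα F m 0 x] at hbad
  have hone := expect_const (G := G) (ident := ident) (Prog.surf α hα F m 0 (ident x)) (1 : ℝ)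
  have hle := expect_le_of_wp (φ := fun _ => (1 : ℝ)) (ψ := fun s : ℝ × ℝ =>
    Set.indicator {y | (1 - ε) * p ≤ y ∧ y ≤ (1 + ε) * p} (1 : ℝ → ℝ)
      ((s.1 + (∑ u ∈ Q.map ident, tableWeight α (ident v) (Q.map ident) T u) * κ * s.2) / m) +
    if m * p * (ε / 3) ≤ |s.1 + avg e * s.2 - m * p| then (1 : ℝ) else 0)
    (wp_surf (G := G) (ident := ident) α hα F m 0 x (2 * m) {ident x} le_rfl
    (Finset.mem_singleton_self _) (P := fun s => 0 ≤ s.1 ∧ 0 ≤ s.2)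
    (fun s y C hs => ⟨add_nonneg hs.1 (hF0 y C).1, add_nonneg hs.2 (hF0 y C).2⟩)
    ⟨le_rfl, le_rfl⟩) ?_
  · rw [expect_add, hone] at hle
    linarith
  rintro - - ⟨z₁, z₂⟩ ⟨hz₁, hz₂⟩
  by_cases hb : m * p * (ε / 3) ≤ |z₁ + avg e * z₂ - m * p|
  · rw [if_pos hb]
    have : (0 : ℝ) ≤ Set.indicator {y | (1 - ε) * p ≤ y ∧ y ≤ (1 + ε) * p} (1 : ℝ → ℝ)
      ((z₁ + (∑ u ∈ Q.map ident, tableWeight α (ident v) (Q.map ident) T u) * κ * z₂) / m) :=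
      Set.indicator_nonneg (fun _ _ => zero_le_one) _
    linarith
  · rw [if_neg hb, add_zero, Set.indicator_of_mem, Pi.one_apply]
    rw [not_le, abs_lt] at hb
    obtain ⟨b1, b2⟩ := hb
    obtain ⟨k1, k2⟩ := abs_le.1 hκ
    have ha : 0 ≤ avg e * z₂ := mul_nonneg (avg_nonneg hnn) hz₂
    have k3 := mul_le_mul_of_nonneg_left k1 ha
    have k4 := mul_le_mul_of_nonneg_left k2 ha
    have hS : avg e * z₂ ≤ z₁ + avg e * z₂ := le_add_of_nonneg_left hz₁
    have k5 := mul_le_mul_of_nonneg_right hS (by positivity : 0 ≤ ε / 3)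
    have hmp : 0 < m * p := mul_pos hmR hp
    have k6 : m * p * (ε / 3) * (ε / 3) ≤ m * p * (ε / 3) := by
      refine mul_le_of_le_one_right (by positivity) (by linarith)
    -- The ergodic average and the estimate of `1/n` each have relative error at most `ε / 3`, and
    -- `(1 + ε / 3)² ≤ 1 + ε`. The second error touches only the nonnegative part `avg e * z₂`.
    rw [Set.mem_ofPred_eq, le_div_iff₀ hmR, div_le_iff₀ hmR, hE]
    have k7 := mul_le_mul_of_nonneg_right b2.le (by positivity : 0 ≤ ε / 3)
    have e1 : avg e * Fintype.card V * κ * z₂ = avg e * z₂ + avg e * z₂ * (κ * Fintype.card V - 1) :=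
      by ring
    rw [e1]
    constructor <;> nlinarith

open Classical in
-- Three failure events of probability at most `ε / 4` each: `hDm` controls the degree estimates,
-- `hmean` the collisions, and `hA` the surfer.
theorem le_expect_estimate (α : NNReal) (h0 : (0 : ℝ) < α) (h1 : (α : ℝ) < 1) (hα : α ≤ 1) (v : V)
    {ε : ℝ} (hε0 : 0 < ε) (hε1 : ε < 1) {m D : ℕ} (hm : 2 ≤ m) (hD : 0 < D)
    (hDm : (Fintype.card V : ℝ) ^ 2 * Real.exp (-(m * (D / Fintype.card V))) ≤ ε / 4)
    (hmean : 36 / ε ^ 3 ≤ meanCollisions V m)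
    (hA : 432 * ((4 * D * Fintype.card V / ((1 - α) * m) + 1 / (1 - α)) / (1 - α)) ≤ ε ^ 3 * m) :
    1 - 3 * ε / 4 ≤ expect G ident (.estimate α hα m (ident v))
      (Set.indicator {y | (1 - ε) * pageRank α G v ≤ y ∧ y ≤ (1 + ε) * pageRank α G v} 1) := by
  set φ : ℝ → ℝ :=
    Set.indicator {y | (1 - ε) * pageRank α G v ≤ y ∧ y ≤ (1 + ε) * pageRank α G v} 1 with hφ
  have hφ0 : ∀ y, 0 ≤ φ y := fun y => Set.indicator_nonneg (fun _ _ => zero_le_one) _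
  have hp : 0 < pageRank α G v := pageRank_pos h0 h1 v
  have hV : (0 : ℝ) < Fintype.card V := by exact_mod_cast Fintype.card_pos
  have hmR : (2 : ℝ) ≤ m := by exact_mod_cast hm
  have h1' : (0 : ℝ) < 1 - α := sub_pos.2 h1
  have hDR : (0 : ℝ) < D := by exact_mod_cast hD
  have hμ : 0 < meanCollisions V m := lt_of_lt_of_le (by positivity) hmean
  have hm1 : (0 : ℝ) < m - 1 := by linarith
  -- Chosen so that `m` nodes of weight `θ / (2 * D)` would have twice the total weight allowed by
  -- `card_mul_le`.
  set θ : ℝ := 4 * D * Fintype.card V * pageRank α G v / ((1 - α) * m) with hθ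
  have hθ0 : 0 < θ := by positivity
  have hcol : drawExp m ([] : List V) (fun L => if meanCollisions V m * (ε / 3) <
      |(collisions L : ℝ) - meanCollisions V m| then 1 else 0) ≤ ε / 4 := by
    refine (drawExp_collisions_chebyshev m (by positivity : 0 < meanCollisions V m * (ε / 3)) _
      fun L _ h => h.le).trans ?_
    rw [div_le_iff₀ (by positivity)]
    rw [div_le_iff₀ (by positivity)] at hmean
    have : ε / 4 * (meanCollisions V m * (ε / 3)) ^ 2 =
      meanCollisions V m * (meanCollisions V m * ε ^ 3) / 36 := by ring
    rw [this]
    nlinarith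
  have hdeg := (drawExp_degree G m hD).trans hDm
  rw [Prog.estimate, expect_bind]
  change _ ≤ expect G ident (Prog.draw m (([] : List V).map ident)) _
  rw [expect_draw]
  have e0 : 1 - 3 * ε / 4 = 1 - ε / 4 - ε / 4 - ε / 4 := by ring
  rw [e0]
  refine le_drawExp_of_bad _ _ hdeg hcol (by linarith) (fun L => expect_nonneg hφ0) ?_
  intro L hL hb1 hb2
  push Not at hb1
  rw [not_lt] at hb2
  rw [expect_bind, ← expect_const (G := G) (ident := ident)
    (Prog.look (L.map ident) fun _ => (∅, ∅)) (1 - ε / 4)]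
  refine expect_le_of_wp (wp_look (L.map ident) _ _ (L.map ident).toFinset le_rfl
    fun x hx => List.mem_toFinset.2 hx) ?_
  rintro - - T ⟨-, -, hT⟩
  have hT' : ∀ u ∈ L.map ident, T.CorrectAt G ident u := fun u hu => hT u (.inl hu)
  have hdg := degreeEstimate_sampleDegree L hT' hb1
  rw [expect, expect_bind, ← expect_const (G := G) (ident := ident)
    (Prog.explore α (ident v) (sampleDegree (L.map ident) T) m {ident v}
      (Function.update T (ident v) (parentIds G ident (ident v), childIds G ident (ident v))))
    (1 - ε / 4)]
  have hw := wp_explore (G := G) (ident := ident) (α := α) (v := v)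
    (d := sampleDegree (L.map ident) T) h0 h1 (by positivity : 0 < 2 * (D : ℝ)) hdg hθ0.le m m
    (parentIds G ident (ident v)) {v}
    (Function.update T (ident v) (parentIds G ident (ident v), childIds G ident (ident v)))
    (Finset.mem_singleton_self v) (fun u hu => by
      rw [Finset.mem_singleton.1 hu]; exact T.correctAt_update _)
    le_rfl (fun u hu => by rw [Finset.mem_singleton.1 hu])
    (.inr fun e _ u hu huv => absurd (Finset.mem_singleton.1 hu) huv)
  rw [Finset.map_singleton] at hw
  refine expect_le_of_wp hw ?_
  rintro - - ⟨R, T'⟩ ⟨-, -, Q', hR, hvQ', hcor, hQ'⟩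
  dsimp only at hR hcor ⊢
  subst hR
  have hgood : ∃ Q'' ⊆ Q', v ∈ Q'' ∧
      GoodCore α G v (fun w => sampleDegree (L.map ident) T (ident w)) Q'' θ := by
    rcases hQ' with h | ⟨hc, hlow⟩
    · exact h
    exfalso
    obtain ⟨e, he⟩ := exists_isCoreWeight h0 h1 (G := G) v Q'
    have h2 := card_mul_le h0 h1 he hvQ' (hlow e he)
    rw [Finset.card_singleton] at hc
    have h3 : (m : ℝ) ≤ Q'.card - 1 := by
      have : (1 : ℝ) + m ≤ Q'.card := by exact_mod_cast hc
      linarith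
    have h4 := (mul_le_mul_of_nonneg_right h3
      (by positivity : 0 ≤ θ / (2 * D))).trans h2
    have h5 : (m : ℝ) * (θ / (2 * D)) =
        2 * (Fintype.card V * (pageRank α G v / (1 - α))) := by
      rw [hθ]; field_simp; ring
    have h6 : 0 < Fintype.card V * (pageRank α G v / (1 - (α : ℝ))) := by positivity
    linarith
  obtain ⟨B, hBQ, hvB, hgB, hB⟩ := bestCore_spec h0 h1 hcor hθ0.le hgood
  rw [hB, expect, ← avg_const (V := V) (1 - ε / 4)]
  refine avg_mono fun x => ?_
  refine le_expect_surf h0 h1 hvB (fun u hu => hcor u (hBQ hu)) hε0 hε1 hθ0.le ?_ ?_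
    (by omega) ?_ hA hα x
  · exact fun e he w hw => (residual_le_bound h0 hdg (he.nonneg h0 h1) w).trans (hgB e he w hw)
  · rw [collisions_map]
    have e1 : 2 * (collisions L : ℝ) / (m * (m - 1)) * Fintype.card V =
        collisions L / meanCollisions V m := by
      unfold meanCollisions; field_simp
    rw [e1, div_sub_one hμ.ne', abs_div, abs_of_pos hμ, div_le_iff₀ hμ, mul_comm]
    exact hb2
  · rw [hθ]
    refine le_of_eq ?_
    field_simp

end estimate

/-! ### Exhaustive exploration -/

/-- The PageRank of `v` on the graph with node set `S` described by a table. -/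
def tableRank (α : ℝ) (S : Finset ℕ) (T : Table) (v : ℕ) : ℝ :=
  Classical.epsilon (fun P : ℕ → ℝ => ∀ j ∈ S, P j = α * (∑ i ∈ S, P i *
    (if (T i).2 = ∅ then (S.card : ℝ)⁻¹ else if j ∈ (T i).2 then ((T i).2.card : ℝ)⁻¹ else 0)) +
      (1 - α) * (S.card : ℝ)⁻¹) v

/-- Query `m` random nodes and hope that these are all the nodes. -/
def Prog.exhaust (α : ℝ) (m v : ℕ) : Prog ℝ :=
  (Prog.draw m []).bind fun l =>
  (Prog.look l fun _ => (∅, ∅)).bind fun T =>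
  .ret (tableRank α l.toFinset T v)

section exhaust
variable {V : Type*} [Fintype V] {G : Digraph V} {ident : V ↪ ℕ}

theorem tableRank_eq {α : ℝ} (h0 : 0 < α) (h1 : α < 1) {T : Table}
    (hT : ∀ u, T.CorrectAt G ident (ident u)) (v : V) :
    tableRank α (Finset.univ.map ident) T (ident v) = pageRank α G v := by
  classical
  have htr : ∀ i j, (if (T (ident i)).2 = ∅ then ((Finset.univ.map ident).card : ℝ)⁻¹ else
      if ident j ∈ (T (ident i)).2 then ((T (ident i)).2.card : ℝ)⁻¹ else 0) =
        transition G i j := by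
    intro i j
    rw [hT i, childIds_ident]
    simp only [transition, Finset.map_eq_empty, Finset.card_map, Finset.mem_map', Finset.card_univ]
  have hex : ∃ P : ℕ → ℝ, ∀ j ∈ Finset.univ.map ident, P j =
      α * (∑ i ∈ Finset.univ.map ident, P i *
        (if (T i).2 = ∅ then ((Finset.univ.map ident).card : ℝ)⁻¹ else
          if j ∈ (T i).2 then ((T i).2.card : ℝ)⁻¹ else 0)) +
        (1 - α) * ((Finset.univ.map ident).card : ℝ)⁻¹ := by
    refine ⟨Function.extend ident (pageRank α G) 0, fun j hj => ?_⟩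
    obtain ⟨x, -, rfl⟩ := Finset.mem_map.1 hj
    simp only [Finset.sum_map, htr, ident.injective.extend_apply]
    rw [Finset.card_map, Finset.card_univ]
    exact (eq_pageRank_iff h0 h1 G _).1 rfl x
  have hs : ∀ j ∈ Finset.univ.map ident, tableRank α (Finset.univ.map ident) T j =
      α * (∑ i ∈ Finset.univ.map ident, tableRank α (Finset.univ.map ident) T i *
        (if (T i).2 = ∅ then ((Finset.univ.map ident).card : ℝ)⁻¹ else
          if j ∈ (T i).2 then ((T i).2.card : ℝ)⁻¹ else 0)) +
        (1 - α) * ((Finset.univ.map ident).card : ℝ)⁻¹ := Classical.epsilon_spec hex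
  have : (fun x => tableRank α (Finset.univ.map ident) T (ident x)) = pageRank α G := by
    refine (eq_pageRank_iff h0 h1 G _).2 fun x => ?_
    have := hs (ident x) (Finset.mem_map_of_mem _ (Finset.mem_univ x))
    rw [Finset.sum_map] at this
    simp only [htr] at this
    rwa [Finset.card_map ident, Finset.card_univ] at this
  exact congrFun this v

theorem wp_exhaust (α : ℝ) (m v b : ℕ) (K : Finset ℕ) (hb : 2 * m ≤ b) :
    wp G ident (.exhaust α m v) (fun _ _ _ => True) b K := by
  refine wp_bind (wp_mono (wp_draw m b K [] (by omega) (by simp)) ?_)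
  rintro b₁ K₁ _ ⟨rfl, hK₁, hl, L, rfl, hL⟩
  rw [List.length_nil, zero_add] at hL
  exact wp_bind (wp_mono (wp_look _ _ _ K₁ (by rw [List.length_map]; omega) hl)
    fun _ _ _ _ => trivial)

/-- Coupon collector: by a union bound over the nodes all of them are sampled, and then the whole
graph is known and the output is exact. -/
theorem le_expect_exhaust [Nonempty V] {α : ℝ} (h0 : 0 < α) (h1 : α < 1) (v : V) {ε : ℝ}
    (hε0 : 0 < ε) {m : ℕ}
    (hm : (Fintype.card V : ℝ) * Real.exp (-(m * (1 / Fintype.card V))) ≤ ε / 4) :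
    1 - 3 * ε / 4 ≤ expect G ident (.exhaust α m (ident v))
      (Set.indicator {y | (1 - ε) * pageRank α G v ≤ y ∧ y ≤ (1 + ε) * pageRank α G v} 1) := by
  classical
  have hp := pageRank_pos (G := G) h0 h1 v
  have hmiss : drawExp m ([] : List V) (fun L => if ∃ w, w ∉ L then 1 else 0) ≤ ε / 4 := by
    refine le_trans ?_ hm
    calc _ ≤ drawExp m ([] : List V) (fun L => ∑ w, if ∀ x ∈ L, x ∉ ({w} : Finset V)
            then (1 : ℝ) else 0) := by
          refine drawExp_mono _ _ fun L _ => ?_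
          split_ifs with h
          · obtain ⟨w, hw⟩ := h
            refine le_trans ?_ (Finset.single_le_sum (fun w _ => ?_) (Finset.mem_univ w))
            · rw [if_pos fun x hx hxw => hw (by rwa [← Finset.mem_singleton.1 hxw])]
            · split_ifs <;> norm_num
          · exact Finset.sum_nonneg fun w _ => by split_ifs <;> norm_num
      _ = ∑ w : V, drawExp m ([] : List V) (fun L => if ∀ x ∈ L, x ∉ ({w} : Finset V)
            then (1 : ℝ) else 0) := drawExp_sum _ _ _ _
      _ ≤ ∑ _w : V, Real.exp (-(m * (1 / Fintype.card V))) := by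
          refine Finset.sum_le_sum fun w _ => ?_
          have := drawExp_miss {w} m ([] : List V)
          rw [Finset.card_singleton, Nat.cast_one] at this
          convert this
      _ = _ := by simp
  have hnever : drawExp m ([] : List V) (fun _ => if False then 1 else 0) ≤ 0 := by
    simp [drawExp_const]
  have hφ0 : ∀ y, 0 ≤ Set.indicator
      {y | (1 - ε) * pageRank α G v ≤ y ∧ y ≤ (1 + ε) * pageRank α G v} (1 : ℝ → ℝ) y :=
    fun y => Set.indicator_nonneg (fun _ _ => zero_le_one) _
  rw [Prog.exhaust, expect_bind]
  change _ ≤ expect G ident (Prog.draw m (([] : List V).map ident)) _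
  rw [expect_draw]
  refine le_trans (by linarith : _ ≤ 1 - ε / 4 - 0) (le_drawExp_of_bad _ _ hmiss hnever le_rfl
    (fun L => expect_nonneg hφ0) ?_)
  intro L _ hL _
  push Not at hL
  rw [expect_bind]
  refine (expect_const (G := G) (ident := ident)
    (Prog.look (L.map ident) fun _ => (∅, ∅)) (1 : ℝ)).ge.trans (expect_le_of_wp (wp_look (L.map ident) _ _ (L.map ident).toFinset le_rfl
    fun x hx => List.mem_toFinset.2 hx) ?_)
  rintro - - T ⟨-, -, hT⟩
  have hS : (L.map ident).toFinset = Finset.univ.map ident := by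
    ext u
    simp [hL]
  rw [expect, hS, tableRank_eq h0 h1 fun u => hT _ (.inl (List.mem_map_of_mem (hL u))),
    Set.indicator_of_mem]
  · rfl
  · rw [Set.mem_ofPred_eq]
    constructor <;> nlinarith

end exhaust

/-! ### Parameters -/

/-- The number of steps of the phases of the algorithm, for graphs with about `N` nodes. -/
def scale (ε N : ℝ) : ℝ := N ^ (2 / 3 : ℝ) * Real.log N ^ (1 / 3 : ℝ) / ε

theorem scale_pow {ε N : ℝ} (hN : 1 < N) : scale ε N ^ 3 = N ^ 2 * Real.log N / ε ^ 3 := by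
  have h := Real.log_pos hN
  have e1 : (N ^ (2 / 3 : ℝ)) ^ 3 = N ^ 2 := by
    rw [← Real.rpow_natCast, ← Real.rpow_mul (by linarith), ← Real.rpow_natCast]
    norm_num
  have e2 : (Real.log N ^ (1 / 3 : ℝ)) ^ 3 = Real.log N := by
    rw [← Real.rpow_natCast, ← Real.rpow_mul h.le]
    norm_num
  rw [scale, div_pow, mul_pow, e1, e2]

theorem scale_pos {ε N : ℝ} (hε : 0 < ε) (hN : 1 < N) : 0 < scale ε N := by
  have h := Real.log_pos hN
  have : 0 < N := by linarith
  unfold scale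
  positivity

theorem log_ge_of_two_le {N : ℝ} (hN : 2 ≤ N) : 0.69 ≤ Real.log N := by
  have := Real.log_two_gt_d9
  have := Real.log_le_log (by norm_num) hN
  linarith

theorem one_le_scale {ε N : ℝ} (hε0 : 0 < ε) (hε1 : ε ≤ 1) (hN : 2 ≤ N) : 1 ≤ scale ε N := by
  rw [← pow_le_pow_iff_left₀ zero_le_one (scale_pos hε0 (by linarith)).le three_ne_zero,
    scale_pow (by linarith), le_div_iff₀ (by positivity)]
  have h := log_ge_of_two_le hN
  have : ε ^ 3 ≤ 1 := pow_le_one₀ hε0.le hε1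
  nlinarith

/-- The search for the number of nodes needs on the order of `√(N / ε)` samples; this bound makes it
affordable. -/
theorem div_le_scale_sq {ε N : ℝ} (hε0 : 0 < ε) (hε1 : ε ≤ 1) (hN : 2 ≤ N) :
    N / ε ≤ 2 * scale ε N ^ 2 := by
  have h := log_ge_of_two_le hN
  rw [← pow_le_pow_iff_left₀ (by positivity) (by positivity) three_ne_zero]
  have e : (2 * scale ε N ^ 2) ^ 3 = 8 * (scale ε N ^ 3) ^ 2 := by ring
  rw [e, scale_pow (by linarith), div_pow, div_pow, ← mul_div_assoc,
    div_le_div_iff₀ (by positivity) (by positivity)]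
  have h1 : 1 ≤ 8 * N * Real.log N ^ 2 := by nlinarith
  have h2 : ε ^ 6 ≤ ε ^ 3 := pow_le_pow_of_le_one hε0.le hε1 (by norm_num)
  calc N ^ 3 * (ε ^ 3) ^ 2 = N ^ 3 * ε ^ 6 := by ring
    _ ≤ N ^ 3 * ε ^ 3 := by gcongr
    _ ≤ N ^ 3 * ε ^ 3 * (8 * N * Real.log N ^ 2) := le_mul_of_one_le_right (by positivity) h1
    _ = _ := by ring

/-- From `N ≤ 8n ≤ n⁴` the logarithm grows by a factor of at most 4, and `64 * 4 ≤ 7 ^ 3`. -/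
theorem scale_le {ε n N : ℝ} (hε0 : 0 < ε) (hn : 2 ≤ n) (hnN : n ≤ N) (hN : N ≤ 8 * n) :
    scale ε N ≤ 7 * scale ε n := by
  rw [← pow_le_pow_iff_left₀ (scale_pos hε0 (by linarith)).le
    (by have := scale_pos hε0 (by linarith : 1 < n); positivity) three_ne_zero, mul_pow,
    scale_pow (by linarith), scale_pow (by linarith), ← mul_div_assoc]
  refine div_le_div_of_nonneg_right ?_ (by positivity)
  have h := log_ge_of_two_le hn
  have h2 : Real.log N ≤ 4 * Real.log n := by
    rw [← Real.log_rpow (by linarith)]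
    refine Real.log_le_log (by linarith) (hN.trans ?_)
    norm_cast
    have : (2 : ℝ) ^ 3 ≤ n ^ 3 := pow_le_pow_left₀ (by norm_num) hn 3
    nlinarith
  have h3 : N ^ 2 ≤ 64 * n ^ 2 := by nlinarith
  calc N ^ 2 * Real.log N ≤ (64 * n ^ 2) * (4 * Real.log n) :=
        mul_le_mul h3 h2 (by linarith [log_ge_of_two_le (hn.trans hnN)]) (by positivity)
    _ ≤ _ := by nlinarith [mul_nonneg (sq_nonneg n) (by linarith : 0 ≤ Real.log n)]

/-! ### Parameter bounds for moderate `ε`. -/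

theorem sq_le_of_moderate {ε N : ℝ} (hN : 2 ≤ N)
    (h : 1 ≤ ε ^ 3 * N * Real.sqrt (Real.log N)) :
    1 ≤ ε ^ 6 * N ^ 2 * Real.log N := by
  have h2 := one_le_pow₀ h (n := 2)
  rw [mul_pow, Real.sq_sqrt (by linarith [log_ge_of_two_le hN])] at h2
  calc 1 ≤ _ := h2
    _ = _ := by ring

/-- After raising to powers the two conditions agree: this is where the threshold between the two
regimes comes from. -/
theorem one_le_of_moderate {ε N : ℝ} (hε0 : 0 < ε) (hN : 2 ≤ N)
    (h : 1 ≤ ε ^ 3 * N * Real.sqrt (Real.log N)) :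
    1 ≤ ε ^ 3 * scale ε N := by
  have h2 := scale_pos hε0 (by linarith : 1 < N)
  rw [← pow_le_pow_iff_left₀ zero_le_one (by positivity) three_ne_zero, mul_pow,
    scale_pow (by linarith)]
  have := sq_le_of_moderate hN h
  calc _ = (1 : ℝ) := by norm_num
    _ ≤ _ := this
    _ = _ := by field_simp

theorem le_sq_of_moderate {ε N : ℝ} (hε0 : 0 < ε) (hN : 2 ≤ N)
    (h : 1 ≤ ε ^ 3 * N * Real.sqrt (Real.log N)) :
    N ≤ 2 * ε ^ 3 * scale ε N ^ 2 := by
  have h2 := scale_pos hε0 (by linarith : 1 < N)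
  have hL := log_ge_of_two_le hN
  rw [← pow_le_pow_iff_left₀ (by positivity) (by positivity) three_ne_zero]
  have e : (2 * ε ^ 3 * scale ε N ^ 2) ^ 3 = 8 * ε ^ 9 * (scale ε N ^ 3) ^ 2 := by ring
  have e2 : 8 * ε ^ 9 * (N ^ 2 * Real.log N / ε ^ 3) ^ 2 =
      N ^ 3 * (8 * (ε ^ 3 * N * Real.log N ^ 2)) := by field_simp
  rw [e, scale_pow (by linarith), e2]
  refine le_mul_of_one_le_right (by positivity) ?_
  have h3 : Real.sqrt (Real.log N) ≤ 8 * Real.log N ^ 2 := by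
    rw [Real.sqrt_le_iff]
    refine ⟨by positivity, ?_⟩
    have : 1 ≤ 64 * Real.log N ^ 3 := by
      have : (0.69 : ℝ) ^ 3 ≤ Real.log N ^ 3 := pow_le_pow_left₀ (by norm_num) hL 3
      norm_num at this ⊢
      linarith
    nlinarith
  calc 1 ≤ ε ^ 3 * N * Real.sqrt (Real.log N) := h
    _ ≤ ε ^ 3 * N * (8 * Real.log N ^ 2) := by gcongr
    _ = _ := by ring

theorem log_inv_le_of_moderate {ε N : ℝ} (hε0 : 0 < ε) (hN : 2 ≤ N)
    (h : 1 ≤ ε ^ 3 * N * Real.sqrt (Real.log N)) :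
    Real.log (1 / ε) ≤ Real.log N / 2 := by
  have hL := log_ge_of_two_le hN
  have h2 := Real.log_nonneg (sq_le_of_moderate hN h)
  rw [Real.log_mul (by positivity) (by positivity), Real.log_mul (by positivity) (by positivity),
    Real.log_pow, Real.log_pow] at h2
  have h3 := Real.log_le_sub_one_of_pos (by linarith : 0 < Real.log N)
  rw [one_div, Real.log_inv]
  push_cast at h2
  linarith

/-! ### Parameter bounds for tiny `ε`. -/

theorem sq_le_of_tiny {ε N : ℝ} (hε0 : 0 < ε) (hε1 : ε < 1) (hN : 2 ≤ N)
    (h : ε ^ 3 * N * Real.sqrt (Real.log N) ≤ 1) :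
    N ^ 2 * Real.log N ≤ (1 / ε) ^ 6 := by
  have hL := log_ge_of_two_le hN
  have h2 := pow_le_one₀ (by positivity) h (n := 2)
  rw [mul_pow, Real.sq_sqrt (by linarith)] at h2
  rw [one_div, inv_pow, ← one_div, le_div_iff₀ (by positivity)]
  calc _ = (ε ^ 3 * N) ^ 2 * Real.log N := by ring
    _ ≤ 1 := h2

theorem log_le_of_tiny {ε N : ℝ} (hε0 : 0 < ε) (hε1 : ε < 1) (hN : 2 ≤ N)
    (h : ε ^ 3 * N * Real.sqrt (Real.log N) ≤ 1) :
    Real.log N ≤ 6 * Real.log (1 / ε) := by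
  have hL := log_ge_of_two_le hN
  have h3 : N ≤ (1 / ε) ^ 6 := le_trans (by nlinarith) (sq_le_of_tiny hε0 hε1 hN h)
  have := Real.log_le_log (by linarith) h3
  rwa [Real.log_pow, Nat.cast_ofNat] at this

theorem mul_log_le_of_tiny {ε N : ℝ} (hε0 : 0 < ε) (hε1 : ε < 1) (hN : 2 ≤ N)
    (h : ε ^ 3 * N * Real.sqrt (Real.log N) ≤ 1) :
    N * Real.log N ≤ 3 * (Real.sqrt (Real.log (1 / ε)) * scale ε N) := by
  have hL := log_ge_of_two_le hN
  have hs := scale_pos hε0 (by linarith : 1 < N)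
  have hx : 0 < Real.log (1 / ε) := Real.log_pos (by rw [lt_div_iff₀ hε0]; linarith)
  have hx2 := Real.sq_sqrt hx.le
  set s := Real.sqrt (Real.log (1 / ε)) with hsdef
  have hs0 : 0 < s := Real.sqrt_pos.2 hx
  have h1 := log_le_of_tiny hε0 hε1 hN h
  rw [← hx2] at h1
  have h2 := sq_le_of_tiny hε0 hε1 hN h
  rw [← pow_le_pow_iff_left₀ (by positivity) (by positivity) (by norm_num : 6 ≠ 0)]
  have e : (3 * (s * scale ε N)) ^ 6 = 729 * s ^ 6 * (scale ε N ^ 3) ^ 2 := by ring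
  rw [e, scale_pow (by linarith)]
  have h3 : Real.log N ^ 3 ≤ (6 * s ^ 2) ^ 3 := pow_le_pow_left₀ (by linarith) h1 3
  calc (N * Real.log N) ^ 6 = N ^ 4 * Real.log N ^ 2 * (N ^ 2 * Real.log N) * Real.log N ^ 3 := by
        ring
    _ ≤ N ^ 4 * Real.log N ^ 2 * (1 / ε) ^ 6 * (6 * s ^ 2) ^ 3 := by gcongr
    _ = 216 * s ^ 6 * (N ^ 2 * Real.log N / ε ^ 3) ^ 2 := by field_simp; norm_num
    _ ≤ 729 * s ^ 6 * (N ^ 2 * Real.log N / ε ^ 3) ^ 2 := by gcongr; norm_num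

/-- One factor `√(log (1/ε))` is split off, and the remaining `N √(log (1/ε))` is at most `2 * scale
ε N`: the logarithm of `1/ε` exceeds that of `N` only as far as `1/ε` exceeds the threshold. -/
theorem mul_log_inv_le_of_tiny {ε N : ℝ} (hε0 : 0 < ε) (hε1 : ε < 1) (hN : 2 ≤ N)
    (h : ε ^ 3 * N * Real.sqrt (Real.log N) ≤ 1) :
    N * Real.log (1 / ε) ≤ 2 * (Real.sqrt (Real.log (1 / ε)) * scale ε N) := by
  have hL := log_ge_of_two_le hN
  have hs := scale_pos hε0 (by linarith : 1 < N)
  have hx : 0 < Real.log (1 / ε) := Real.log_pos (by rw [lt_div_iff₀ hε0]; linarith)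
  have hx2 := Real.sq_sqrt hx.le
  have h2 := sq_le_of_tiny hε0 hε1 hN h
  set x := 1 / ε with hxdef
  have hx0 : 0 < x := by positivity
  set s := Real.sqrt (Real.log x) with hsdef
  have hs0 : 0 < s := Real.sqrt_pos.2 hx
  have hy0 : 0 < x ^ 6 / (N ^ 2 * Real.log N) := by positivity
  -- The cube root `z` measures the distance to the threshold; `log z ≤ z - 1` trades the excess
  -- logarithm for a factor `z`.
  obtain ⟨z, hz0, hz⟩ : ∃ z : ℝ, 0 < z ∧ z ^ 3 = x ^ 6 / (N ^ 2 * Real.log N) :=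
    ⟨_, Real.rpow_pos_of_pos hy0 (1 / 3), by
      rw [← Real.rpow_natCast, ← Real.rpow_mul hy0.le]; norm_num⟩
  have hz1 : 1 ≤ z := by
    rw [← pow_le_pow_iff_left₀ zero_le_one hz0.le three_ne_zero, hz, one_pow,
      one_le_div (by positivity)]
    exact h2
  have hzx : z ^ 3 * (N ^ 2 * Real.log N) = x ^ 6 := by rw [hz]; field_simp
  have hlog : Real.log x ≤ 2 * Real.log N * z := by
    have h3 := congrArg Real.log hzx
    rw [Real.log_mul (by positivity) (by positivity), Real.log_mul (by positivity) (by positivity),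
      Real.log_pow, Real.log_pow, Real.log_pow] at h3
    push_cast at h3
    have h4 := Real.log_le_sub_one_of_pos hz0
    have h5 := Real.log_le_sub_one_of_pos (by linarith : 0 < Real.log N)
    nlinarith
  rw [← hx2] at hlog ⊢
  have hkey : N * s ≤ 2 * scale ε N := by
    rw [← pow_le_pow_iff_left₀ (by positivity) (by positivity) (by norm_num : 6 ≠ 0)]
    have e : (2 * scale ε N) ^ 6 = 64 * (scale ε N ^ 3) ^ 2 := by ring
    have e2 : N ^ 2 * Real.log N / ε ^ 3 = N ^ 2 * Real.log N * x ^ 3 := by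
      rw [hxdef]; field_simp
    rw [e, scale_pow (by linarith), e2]
    calc (N * s) ^ 6 = N ^ 6 * (s ^ 2) ^ 3 := by ring
      _ ≤ N ^ 6 * (2 * Real.log N * z) ^ 3 := by gcongr
      _ = 8 * N ^ 4 * Real.log N ^ 2 * (z ^ 3 * (N ^ 2 * Real.log N)) := by ring
      _ = 8 * (N ^ 2 * Real.log N * x ^ 3) ^ 2 := by rw [hzx]; ring
      _ ≤ 64 * (N ^ 2 * Real.log N * x ^ 3) ^ 2 := by gcongr; norm_num
  nlinarith

/-- Here `B` is the scale and `β = 1 / (1 - α)²`. The last three bounds match the three terms in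
`block_bound`. -/
theorem moderate_bounds {ε N L B β m : ℝ} (hε0 : 0 < ε) (hN : 0 < N) (hL : 0 < L) (hB : 1 ≤ B)
    (p1 : 1 ≤ ε ^ 3 * B) (p2 : N ≤ 2 * ε ^ 3 * B ^ 2) (p3 : ε ^ 3 * B ^ 3 = N ^ 2 * L)
    (hβ : 1 ≤ β) (hm : 1296 * β * B ≤ m) :
    2 ≤ m ∧ N * (6000 * β) ≤ ε ^ 3 * m ^ 2 ∧ 1296 * β ≤ ε ^ 3 * m ∧
      N ^ 2 * L * (25920 * β) ≤ ε ^ 3 * m ^ 3 := by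
  have hβB : 1 ≤ β * B := one_le_mul_of_one_le_of_one_le hβ hB
  have hβ0 : 0 < β := by linarith
  have hB0 : 0 < B := by linarith
  have hε3 : 0 < ε ^ 3 := by positivity
  have hsq : (1296 * β * B) ^ 2 ≤ m ^ 2 := pow_le_pow_left₀ (by positivity) hm 2
  have hcu : (1296 * β * B) ^ 3 ≤ m ^ 3 := pow_le_pow_left₀ (by positivity) hm 3
  have hββ : β ≤ β ^ 2 := le_self_pow₀ hβ two_ne_zero
  have hβββ : β ≤ β ^ 3 := le_self_pow₀ hβ three_ne_zero
  refine ⟨by linarith, ?_, ?_, ?_⟩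
  · calc N * (6000 * β) ≤ (2 * ε ^ 3 * B ^ 2) * (6000 * β ^ 2) :=
          mul_le_mul p2 (by linarith) (by positivity) (by positivity)
      _ = ε ^ 3 * (12000 * (β ^ 2 * B ^ 2)) := by ring
      _ ≤ ε ^ 3 * (1296 * β * B) ^ 2 := by
        refine mul_le_mul_of_nonneg_left ?_ hε3.le
        have : 0 ≤ β ^ 2 * B ^ 2 := by positivity
        have e : (1296 * β * B) ^ 2 = 1296 ^ 2 * (β ^ 2 * B ^ 2) := by ring
        rw [e]
        exact mul_le_mul_of_nonneg_right (by norm_num) this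
      _ ≤ _ := mul_le_mul_of_nonneg_left hsq hε3.le
  · calc 1296 * β ≤ 1296 * β * (ε ^ 3 * B) := le_mul_of_one_le_right (by positivity) p1
      _ = ε ^ 3 * (1296 * β * B) := by ring
      _ ≤ _ := mul_le_mul_of_nonneg_left hm hε3.le
  · calc N ^ 2 * L * (25920 * β) ≤ N ^ 2 * L * (1296 ^ 3 * β ^ 3) := by
          refine mul_le_mul_of_nonneg_left ?_ (by positivity)
          exact mul_le_mul (by norm_num) hβββ hβ0.le (by norm_num)
      _ = ε ^ 3 * (1296 * β * B) ^ 3 := by rw [← p3]; ring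
      _ ≤ _ := mul_le_mul_of_nonneg_left hcu hε3.le

/-- Inserting the bound for `D` yields a main term in `N ^ 2 * L / m ^ 2`, a rounding term in `N /
m` and a constant, each at most a third of `ε ^ 3 * m`. -/
theorem block_bound {ε N L β m n D ℓ : ℝ} (hn0 : 0 < n) (hnN : n ≤ N) (hm0 : 0 < m)
    (hβ : 0 < β) (hℓ0 : 0 < ℓ) (hℓL : ℓ ≤ 5 * L) (hD : D ≤ n * ℓ / m + 1)
    (q1 : N * (6000 * β) ≤ ε ^ 3 * m ^ 2) (q2 : 1296 * β ≤ ε ^ 3 * m)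
    (q3 : N ^ 2 * L * (25920 * β) ≤ ε ^ 3 * m ^ 3) :
    432 * β * (4 * D * n / m + 1) ≤ ε ^ 3 * m := by
  have hN0 : 0 < N := by linarith
  have hL0 : 0 < L := by linarith
  have t1 : N ^ 2 * L * (25920 * β) / m ^ 2 ≤ ε ^ 3 * m := by
    rw [div_le_iff₀ (by positivity)]
    linarith
  have t2 : N * (6000 * β) / m ≤ ε ^ 3 * m := by
    rw [div_le_iff₀ hm0]
    linarith
  have hD2 : D * n ≤ N ^ 2 * (5 * L) / m + N := by
    calc D * n ≤ (N * (5 * L) / m + 1) * N := by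
          refine mul_le_mul (hD.trans ?_) hnN hn0.le (by positivity)
          have : n * ℓ ≤ N * (5 * L) := mul_le_mul hnN hℓL hℓ0.le hN0.le
          have := div_le_div_of_nonneg_right this hm0.le
          linarith
      _ = _ := by ring
  have t3 : 4 * D * n / m ≤ 4 * (N ^ 2 * (5 * L) / m + N) / m :=
    div_le_div_of_nonneg_right (by linarith) hm0.le
  have t4 : 432 * β * (4 * (N ^ 2 * (5 * L) / m + N) / m + 1) =
      (N ^ 2 * L * (25920 * β) / m ^ 2 + N * (5184 * β) / m + 1296 * β) / 3 := by
    field_simp; ring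
  have t5 : N * (5184 * β) / m ≤ N * (6000 * β) / m := by
    refine div_le_div_of_nonneg_right ?_ hm0.le
    have : 0 < N * β := by positivity
    linarith
  calc 432 * β * (4 * D * n / m + 1)
      ≤ 432 * β * (4 * (N ^ 2 * (5 * L) / m + N) / m + 1) := by gcongr
    _ ≤ _ := by rw [t4]; linarith

theorem exists_block_size {α ε n N m : ℝ} (h0 : 0 < α) (h1 : α < 1) (hε0 : 0 < ε) (hε1 : ε < 1)
    (hn : 2 ≤ n) (hnN : n ≤ N) (h : 1 ≤ ε ^ 3 * N * Real.sqrt (Real.log N))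
    (hm : 1296 / (1 - α) ^ 2 * scale ε N ≤ m) :
    2 ≤ m ∧ 36 / ε ^ 3 ≤ m * (m - 1) / (2 * n) ∧ ∃ D : ℕ, 0 < D ∧
      n ^ 2 * Real.exp (-(m * (D / n))) ≤ ε / 4 ∧
      432 * ((4 * D * n / ((1 - α) * m) + 1 / (1 - α)) / (1 - α)) ≤ ε ^ 3 * m := by
  have hN : 2 ≤ N := hn.trans hnN
  have hL := log_ge_of_two_le hN
  have h1' : 0 < 1 - α := sub_pos.2 h1
  have hε3 : 0 < ε ^ 3 := by positivity
  have hβ1 : 1 ≤ 1 / (1 - α) ^ 2 := by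
    rw [le_div_iff₀ (by positivity), one_mul]
    exact pow_le_one₀ h1'.le (by linarith)
  obtain ⟨hm2, q1, q2, q3⟩ := moderate_bounds (m := m) hε0 (by linarith) (by linarith : 0 < Real.log N)
    (one_le_scale hε0 hε1.le hN) (one_le_of_moderate hε0 hN h) (le_sq_of_moderate hε0 hN h)
    (by rw [scale_pow (by linarith), mul_div_cancel₀ _ hε3.ne']) hβ1 (by rwa [mul_one_div])
  have hm0 : 0 < m := by linarith
  have hn0 : 0 < n := by linarith
  refine ⟨hm2, ?_, ?_⟩
  · rw [div_le_div_iff₀ hε3 (by positivity)]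
    have : m ^ 2 ≤ 2 * (m * (m - 1)) := by nlinarith
    have : ε ^ 3 * m ^ 2 ≤ ε ^ 3 * (2 * (m * (m - 1))) := mul_le_mul_of_nonneg_left this hε3.le
    have : N * 6000 ≤ N * (6000 * (1 / (1 - α) ^ 2)) :=
      mul_le_mul_of_nonneg_left (by linarith) (by linarith)
    linarith
  have hℓ0 : 0 < Real.log (4 * n ^ 2 / ε) :=
    Real.log_pos (by rw [lt_div_iff₀ hε0]; nlinarith)
  have hℓL : Real.log (4 * n ^ 2 / ε) ≤ 5 * Real.log N := by
    have e : 4 * n ^ 2 / ε ≤ N ^ 4 * (1 / ε) := by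
      rw [← mul_one_div]
      refine mul_le_mul_of_nonneg_right ?_ (by positivity)
      have : n ^ 2 ≤ N ^ 2 := pow_le_pow_left₀ hn0.le hnN 2
      have : (2 : ℝ) ^ 2 ≤ N ^ 2 := pow_le_pow_left₀ (by norm_num) hN 2
      nlinarith
    have := Real.log_le_log (by positivity) e
    rw [Real.log_mul (by positivity) (by positivity), Real.log_pow] at this
    have := log_inv_le_of_moderate hε0 hN h
    push_cast at *
    linarith
  -- The least integer block size for which the union bound in `drawExp_degree` is at most `ε / 4`.
  refine ⟨⌈n * Real.log (4 * n ^ 2 / ε) / m⌉₊, Nat.ceil_pos.2 (by positivity), ?_, ?_⟩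
  · have h2 : Real.log (4 * n ^ 2 / ε) ≤ m * (⌈n * Real.log (4 * n ^ 2 / ε) / m⌉₊ / n) := by
      rw [mul_div_assoc', le_div_iff₀ hn0, mul_comm (Real.log _), ← div_le_iff₀' hm0]
      exact Nat.le_ceil _
    refine (mul_le_mul_of_nonneg_left (Real.exp_le_exp.2 (neg_le_neg h2)) (sq_nonneg n)).trans ?_
    rw [Real.exp_neg, Real.exp_log (by positivity)]
    refine le_of_eq ?_
    field_simp
  · have hD := (Nat.ceil_lt_add_one (by positivity :
      0 ≤ n * Real.log (4 * n ^ 2 / ε) / m)).le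
    refine le_trans (le_of_eq ?_) (block_bound (β := 1 / (1 - α) ^ 2) hn0 hnN hm0
      (by positivity) hℓ0 hℓL hD q1 q2 q3)
    field_simp

/-! ### The algorithm -/

theorem exists_mul_pred_le (B : ℕ) : ∃ x : ℕ, x * (x - 1) ≤ B ∧ B < (x + 1) * x := by
  have hex : ∃ x : ℕ, B < (x + 1) * x := ⟨B + 1, by nlinarith⟩
  classical
  refine ⟨Nat.find hex, ?_, Nat.find_spec hex⟩
  rcases Nat.eq_zero_or_pos (Nat.find hex) with h | h
  · simp [h]
  · have := Nat.find_min hex (Nat.sub_lt h one_pos)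
    have e : Nat.find hex - 1 + 1 = Nat.find hex := by omega
    rwa [not_lt, e] at this

theorem cast_mul_pred (q : ℕ) : ((q * (q - 1) : ℕ) : ℝ) = q * (q - 1) := by
  cases q <;> simp

/-- The mean number of collisions is at most `k / 2` after `q₀` samples and at least `2 * k` after
`F`. Chebyshev bounds each exceptional event by `2 / k ≤ ε / 8`. -/
theorem one_sub_le_birthdayValue {V : Type*} [Fintype V] [Nonempty V] [DecidableEq V] {k : ℕ}
    {ψ : ℕ → ℝ} {ε : ℝ} (hε0 : 0 < ε) (hk : 16 / ε ≤ k) (hψ : ∀ q, 0 ≤ ψ q) {q₀ F : ℕ}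
    (hq₀ : q₀ * (q₀ - 1) ≤ k * Fintype.card V) (hF : 4 * (k * Fintype.card V) ≤ F * (F - 1))
    (h : ∀ q, q₀ < q → q ≤ F → 1 - 3 * ε / 4 ≤ ψ q) :
    1 - ε ≤ birthdayValue k ψ F ([] : List V) := by
  have hV : (0 : ℝ) < Fintype.card V := by exact_mod_cast Fintype.card_pos
  have hk0 : (0 : ℝ) < k := lt_of_lt_of_le (by positivity) hk
  have hkε : 2 / (k : ℝ) ≤ ε / 8 := by
    rw [div_le_iff₀ hε0] at hk
    rw [div_le_div_iff₀ hk0 (by norm_num)]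
    linarith
  have hμ0 : meanCollisions V q₀ ≤ k / 2 := by
    rw [meanCollisions, div_le_div_iff₀ (by positivity) two_pos, ← cast_mul_pred]
    have : ((q₀ * (q₀ - 1) : ℕ) : ℝ) ≤ k * Fintype.card V := by exact_mod_cast hq₀
    linarith
  have hμF : 2 * (k : ℝ) ≤ meanCollisions V F := by
    rw [meanCollisions, le_div_iff₀ (by positivity), ← cast_mul_pred]
    have : 4 * ((k : ℝ) * Fintype.card V) ≤ ((F * (F - 1) : ℕ) : ℝ) := by exact_mod_cast hF
    linarith
  have hlo : drawExp q₀ ([] : List V) (fun l => if k ≤ collisions l then (1 : ℝ) else 0) ≤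
      ε / 8 := by
    refine (drawExp_collisions_chebyshev q₀ (half_pos hk0) _ fun l _ hl => ?_).trans ?_
    · have : (k : ℝ) ≤ collisions l := by exact_mod_cast hl
      exact le_trans (by linarith) (le_abs_self _)
    · refine (div_le_div_of_nonneg_right hμ0 (by positivity)).trans (le_trans (le_of_eq ?_) hkε)
      field_simp
  have hhi : drawExp F ([] : List V) (fun l => if collisions l < k then (1 : ℝ) else 0) ≤
      ε / 8 := by
    have hμ : 0 < meanCollisions V F := by linarith
    refine (drawExp_collisions_chebyshev F (half_pos hμ) _ fun l _ hl => ?_).trans ?_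
    · have : (collisions l : ℝ) < k := by exact_mod_cast hl
      exact le_trans (by linarith) (neg_le_abs _)
    · have e : meanCollisions V F / (meanCollisions V F / 2) ^ 2 = 4 / meanCollisions V F := by
        field_simp; norm_num
      rw [e]
      refine le_trans ?_ hkε
      rw [div_le_div_iff₀ hμ hk0]
      linarith
  have := le_birthdayValue_add (k := k) hψ (by linarith : 1 - 3 * ε / 4 ≤ 1) q₀ F ([] : List V)
    fun q hq hqF => h q hq (by simpa using hqF)
  simp only [List.length_nil, Nat.zero_le, if_true, Nat.sub_zero] at this
  linarith

/-- The continuation after the search for the number of nodes, for `N` nodes. -/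
def mainPhase (α : NNReal) (hα : α ≤ 1) (ε N : ℝ) (v : ℕ) : Prog ℝ :=
  if 1 ≤ ε ^ 3 * N * Real.sqrt (Real.log N) then
    .estimate α hα ⌈1296 / (1 - (α : ℝ)) ^ 2 * scale ε N⌉₊ v
  else .exhaust α ⌈N * Real.log (4 * N / ε)⌉₊ v

section mainPhase
variable {V : Type*} [Fintype V] [Nonempty V] {G : Digraph V} {ident : V ↪ ℕ}

theorem le_expect_mainPhase (α : NNReal) (h0 : (0 : ℝ) < α) (h1 : (α : ℝ) < 1) (hα : α ≤ 1)
    (v : V) {ε N : ℝ} (hε0 : 0 < ε) (hε1 : ε < 1) (hn : 2 ≤ (Fintype.card V : ℝ))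
    (hN : Fintype.card V ≤ N) :
    1 - 3 * ε / 4 ≤ expect G ident (mainPhase α hα ε N (ident v))
      (Set.indicator {y | (1 - ε) * pageRank α G v ≤ y ∧ y ≤ (1 + ε) * pageRank α G v} 1) := by
  unfold mainPhase
  split_ifs with h
  · obtain ⟨hm2, hmean, D, hD, hDm, hA⟩ := exists_block_size h0 h1 hε0 hε1 hn hN h (Nat.le_ceil _)
    exact le_expect_estimate α h0 h1 hα v hε0 hε1 (by exact_mod_cast hm2) hD hDm hmean hA
  · refine le_expect_exhaust h0 h1 v hε0 ?_
    have hn0 : (0 : ℝ) < Fintype.card V := by linarith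
    have h2 : Real.log (4 * Fintype.card V / ε) ≤
        ⌈N * Real.log (4 * N / ε)⌉₊ * (1 / Fintype.card V) := by
      rw [mul_one_div, le_div_iff₀ hn0]
      refine le_trans ?_ (Nat.le_ceil _)
      rw [mul_comm]
      refine mul_le_mul hN (Real.log_le_log (by positivity) (by gcongr)) (Real.log_nonneg ?_)
        (by linarith)
      rw [le_div_iff₀ hε0]; linarith
    refine (mul_le_mul_of_nonneg_left (Real.exp_le_exp.2 (neg_le_neg h2)) hn0.le).trans ?_
    rw [Real.exp_neg, Real.exp_log (by positivity)]
    refine le_of_eq ?_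
    field_simp

/-- The constant of the query bound, where `s₀` is a lower bound of `√(log (1/ε))`. -/
def queryConst (α s₀ : ℝ) : ℝ := (21 + 35 * (1296 / (1 - α) ^ 2)) / s₀ + 154

theorem scale_le_queryConst_mul_rate {α ε s₀ : ℝ} {n : ℕ} (h1 : 0 < 1 - α) (hε0 : 0 < ε)
    (hε1 : ε < 1) (hn : 2 ≤ (n : ℝ)) (hs₀ : 0 < s₀) (hs : s₀ ≤ Real.sqrt (Real.log (1 / ε))) :
    14 * scale ε n ≤ queryConst α s₀ * rate ε n := by
  have hR := scale_pos hε0 (by linarith : (1 : ℝ) < n)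
  have hrate : rate ε n = Real.sqrt (Real.log (1 / ε)) * scale ε n := by
    unfold rate scale; ring
  have hC : 14 / s₀ ≤ queryConst α s₀ := by
    unfold queryConst
    have : 14 / s₀ ≤ (21 + 35 * (1296 / (1 - α) ^ 2)) / s₀ := by
      refine div_le_div_of_nonneg_right ?_ hs₀.le
      have : 0 ≤ 1296 / (1 - α) ^ 2 := by positivity
      linarith
    linarith
  rw [hrate]
  calc 14 * scale ε n = 14 / s₀ * (s₀ * scale ε n) := by field_simp
    _ ≤ queryConst α s₀ * (Real.sqrt (Real.log (1 / ε)) * scale ε n) := by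
      refine mul_le_mul hC (mul_le_mul_of_nonneg_right hs hR.le) (by positivity) ?_
      exact le_trans (by positivity) hC

/-- Write `R` for the scale at `n`, `s = √(log (1/ε))` and `c = 1296 / (1 - α)²`. With the search
included, the first branch costs at most `14R + 5(7cR + 1) + 2 ≤ (21 + 35c)R`, the second at most
`14R + 2 * (7 * 11 * s * R + 1) ≤ 16R + 154sR`; and `R ≤ s * R / s₀`. -/
theorem wp_mainPhase (α : NNReal) (h0 : 0 < α) (h1 : α < 1) (v : V) {ε N s₀ : ℝ}
    (hε0 : 0 < ε) (hε1 : ε < 1) (hn : 2 ≤ (Fintype.card V : ℝ)) (hN : Fintype.card V ≤ N)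
    (hN8 : N ≤ 8 * Fintype.card V) (hs₀ : 0 < s₀) (hs : s₀ ≤ Real.sqrt (Real.log (1 / ε))) {F : ℕ}
    (hF : (F : ℝ) ≤ 14 * scale ε (Fintype.card V)) (b : ℕ) (K : Finset ℕ)
    (hb : ⌊queryConst α s₀ * rate ε (Fintype.card V)⌋₊ - F ≤ b) (hK : ident v ∈ K) :
    wp G ident (mainPhase α h1.le ε N (ident v)) (fun _ _ _ => True) b K := by
  have h1' : (0 : ℝ) < 1 - α := sub_pos.2 (by exact_mod_cast h1)
  have hN2 : 2 ≤ N := hn.trans hN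
  have hR1 := one_le_scale hε0 hε1.le hn
  have hB := scale_le hε0 hn hN hN8
  have hB0 := scale_pos hε0 (by linarith : 1 < N)
  have hrate : rate ε (Fintype.card V) =
      Real.sqrt (Real.log (1 / ε)) * scale ε (Fintype.card V) := by
    unfold rate scale; ring
  set R := scale ε (Fintype.card V) with hR
  set s := Real.sqrt (Real.log (1 / ε)) with hs_def
  have hRs : R ≤ s * R / s₀ := by
    rw [le_div_iff₀ hs₀, mul_comm]
    exact mul_le_mul_of_nonneg_right hs (by linarith)
  have hs0 : 0 < s := by linarith
  have key : ∀ x : ℕ, (F + x : ℝ) ≤ queryConst α s₀ * (s * R) → x ≤ b := by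
    intro x hx
    have : F + x ≤ ⌊queryConst α s₀ * rate ε (Fintype.card V)⌋₊ := by
      refine Nat.le_floor ?_
      rw [hrate]
      exact_mod_cast hx
    omega
  have hc0 : 0 ≤ 1296 / (1 - (α : ℝ)) ^ 2 := by positivity
  have e : queryConst α s₀ * (s * R) =
      (21 + 35 * (1296 / (1 - (α : ℝ)) ^ 2)) * (s * R / s₀) + 154 * (s * R) := by
    unfold queryConst; ring
  have hsR : 0 ≤ s * R := by positivity
  unfold mainPhase
  split_ifs with h
  · refine wp_estimate α h0 h1 _ v b K (key _ ?_) hK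
    have h2 := (Nat.ceil_lt_add_one (mul_nonneg hc0 hB0.le)).le
    have h3 := mul_le_mul_of_nonneg_left hB hc0
    have h4 := mul_le_mul_of_nonneg_left hRs (by linarith :
      0 ≤ 21 + 35 * (1296 / (1 - (α : ℝ)) ^ 2))
    rw [e]
    push_cast
    linarith
  · refine wp_exhaust α _ _ b K (key _ ?_)
    have hlog4 : Real.log (4 * N / ε) ≤ 3 * Real.log N + Real.log (1 / ε) := by
      have : 4 * N / ε = 4 * N * (1 / ε) := by ring
      rw [this, Real.log_mul (by positivity) (by positivity)]
      have : Real.log (4 * N) ≤ 3 * Real.log N := by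
        have e3 : 3 * Real.log N = Real.log (N ^ 3) := by rw [Real.log_pow]; norm_num
        rw [e3]
        refine Real.log_le_log (by positivity) ?_
        have : (2 : ℝ) ^ 2 ≤ N ^ 2 := pow_le_pow_left₀ (by norm_num) hN2 2
        nlinarith
      linarith
    have h2 := mul_log_le_of_tiny hε0 hε1 hN2 (not_le.1 h).le
    have h3 := mul_log_inv_le_of_tiny hε0 hε1 hN2 (not_le.1 h).le
    have h4 := mul_le_mul_of_nonneg_left hlog4 (by linarith : 0 ≤ N)
    have h5 : 0 ≤ N * Real.log (4 * N / ε) := by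
      refine mul_nonneg (by linarith) (Real.log_nonneg ?_)
      rw [le_div_iff₀ hε0]; linarith
    have h6 := (Nat.ceil_lt_add_one h5).le
    have h7 := mul_le_mul_of_nonneg_left hB hs0.le
    have h8 : 16 * R ≤ 21 * (s * R / s₀) := by linarith
    have h9 : 0 ≤ 35 * (1296 / (1 - (α : ℝ)) ^ 2) * (s * R / s₀) := by positivity
    rw [e]
    push_cast
    linarith

end mainPhase

end LocalPageRank
end

theorem theorem1 (α : ℝ) (hα0 : 0 < α) (hα1 : α < 1) (ε₀ : ℝ) (hε₀0 : 0 < ε₀) (hε₀1 : ε₀ < 1) :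
    ∃ C : ℝ, 0 < C ∧ ∀ ε : ℝ, 0 < ε → ε ≤ ε₀ →
      ∃ A : LocalPageRank.Algorithm,
        ∀ (V : Type*) [Fintype V] [Nontrivial V] (G : Digraph V) (ident : V ↪ ℕ) (v : V),
          ENNReal.ofReal (1 - ε) ≤
            LocalPageRank.successProb α ε G ident A
              ⌊C * LocalPageRank.rate ε (Fintype.card V)⌋₊ v := by
  classical
  -- That `ε` stays away from 1 keeps the factor `√(log (1/ε))` of the rate bounded below.
  have hx₀ : 0 < Real.log (1 / ε₀) := Real.log_pos (by rw [lt_div_iff₀ hε₀0]; linarith)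
  have hs₀ := Real.sqrt_pos.2 hx₀
  have hα1' : 0 < 1 - α := sub_pos.2 hα1
  lift α to NNReal using hα0.le
  have h1 : α < 1 := by exact_mod_cast hα1
  refine ⟨LocalPageRank.queryConst α (Real.sqrt (Real.log (1 / ε₀))), by
    unfold LocalPageRank.queryConst; positivity, fun ε hε0 hε => ?_⟩
  have hε1 : ε < 1 := by linarith
  have hs : Real.sqrt (Real.log (1 / ε₀)) ≤ Real.sqrt (Real.log (1 / ε)) :=
    Real.sqrt_le_sqrt (Real.log_le_log (by positivity) (by gcongr))
  set k := ⌈16 / ε⌉₊ with hk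
  have hk1 : 16 / ε ≤ k := Nat.le_ceil _
  have hk2 : (k : ℝ) ≤ 17 / ε := by
    have := (Nat.ceil_lt_add_one (by positivity : 0 ≤ 16 / ε)).le
    have : 1 ≤ 1 / ε := by rw [le_div_iff₀ hε0]; linarith
    have : 17 / ε = 16 / ε + 1 / ε := by ring
    linarith
  have hk0 : (16 : ℝ) ≤ k := by
    refine le_trans ?_ hk1
    rw [le_div_iff₀ hε0]; linarith
  refine ⟨LocalPageRank.birthdaySearch k fun v q =>
    LocalPageRank.mainPhase α h1.le ε (q * (q - 1) / k) v, fun V _ _ G ident v => ?_⟩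
  have hcard : 2 ≤ Fintype.card V := Fintype.one_lt_card
  have hn : (2 : ℝ) ≤ Fintype.card V := by exact_mod_cast hcard
  -- After `q` samples the estimate of `n` is `q(q-1)/k`. It is at least `n` for `q > q₀`, and at
  -- most `8n` for `q ≤ F + 1`; the cutoff is `F + 1`, the first count at which the mean number of
  -- collisions exceeds `2 * k`.
  obtain ⟨q₀, hq₀, hq₀'⟩ := LocalPageRank.exists_mul_pred_le (k * Fintype.card V)
  obtain ⟨F, hF, hF'⟩ := LocalPageRank.exists_mul_pred_le (4 * (k * Fintype.card V))
  have hR1 := LocalPageRank.one_le_scale hε0 hε1.le hn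
  have hFR : ((F + 1 : ℕ) : ℝ) ≤ 14 * LocalPageRank.scale ε (Fintype.card V) := by
    have h2 := LocalPageRank.div_le_scale_sq hε0 hε1.le hn
    have h3 : ((F * (F - 1) : ℕ) : ℝ) ≤ 4 * (k * Fintype.card V) := by exact_mod_cast hF
    rw [LocalPageRank.cast_mul_pred] at h3
    have h4 : (k : ℝ) * Fintype.card V ≤ 17 * (Fintype.card V / ε) := by
      calc (k : ℝ) * Fintype.card V ≤ 17 / ε * Fintype.card V := by gcongr
        _ = _ := by ring
    push_cast
    by_contra hcon
    rw [not_le] at hcon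
    nlinarith
  have hF8 : ((F + 1 : ℕ) : ℝ) * ((F + 1 : ℕ) - 1) ≤ 8 * (k * Fintype.card V) := by
    have h3 : ((F * (F - 1) : ℕ) : ℝ) ≤ 4 * (k * Fintype.card V) := by exact_mod_cast hF
    rw [LocalPageRank.cast_mul_pred] at h3
    have h4 : (32 : ℝ) ≤ k * Fintype.card V := by nlinarith
    push_cast
    nlinarith [sq_nonneg ((F : ℝ) - 4)]
  have hFb : F + 1 ≤ ⌊LocalPageRank.queryConst α (Real.sqrt (Real.log (1 / ε₀))) *
      LocalPageRank.rate ε (Fintype.card V)⌋₊ :=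
    Nat.le_floor (hFR.trans (LocalPageRank.scale_le_queryConst_mul_rate hα1' hε0 hε1 hn hs₀ hs))
  set good : Set ℝ := {y | (1 - ε) * LocalPageRank.pageRank α G v ≤ y ∧
    y ≤ (1 + ε) * LocalPageRank.pageRank α G v} with hgood
  -- Success is credited only for stopping counts whose estimate of `n` lies in `[n, 8n]`.
  set ψ : ℕ → ℝ := fun q => if q₀ < q ∧ q ≤ F + 1 then 1 - 3 * ε / 4 else 0 with hψ
  have hψ0 : ∀ q, 0 ≤ ψ q := fun q => by
    simp only [hψ]
    split_ifs <;> linarith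
  have hval := LocalPageRank.one_sub_le_birthdayValue (V := V) hε0 hk1 hψ0 hq₀
    (by rw [Nat.add_sub_cancel]; exact hF'.le) fun q h2 h3 => by simp only [hψ, if_pos (And.intro h2 h3), le_refl]
  have hrun := LocalPageRank.birthdayValue_le_run (G := G) (ident := ident) (k := k)
    (main := fun v q => LocalPageRank.mainPhase α h1.le ε (q * (q - 1) / k) v) good v ψ hψ0
    (⌊LocalPageRank.queryConst α (Real.sqrt (Real.log (1 / ε₀))) *
      LocalPageRank.rate ε (Fintype.card V)⌋₊ - (F + 1)) ?_ (F + 1) [] _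
    (Nat.add_sub_of_le hFb).le {ident v} (Finset.mem_singleton_self _)
  · refine (ENNReal.ofReal_le_ofReal hval).trans (hrun.trans (le_of_eq ?_))
    unfold LocalPageRank.successProb
    congr 1
    ext o
    simp only [hgood, Set.mem_image, Set.mem_ofPred_eq]
    constructor
    · rintro ⟨x, hx, rfl⟩; exact ⟨x, rfl, hx⟩
    · rintro ⟨x, rfl, hx⟩; exact ⟨x, hx, rfl⟩
  · intro q
    by_cases hq : q₀ < q ∧ q ≤ F + 1
    · right
      have hkpos : (0 : ℝ) < k := by linarith
      have hqF : (q : ℝ) ≤ (F + 1 : ℕ) := by exact_mod_cast hq.2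
      have hq1 : (1 : ℝ) ≤ q := by exact_mod_cast (Nat.zero_le q₀).trans_lt hq.1
      have hN : (Fintype.card V : ℝ) ≤ q * (q - 1) / k := by
        rw [le_div_iff₀ hkpos, mul_comm]
        have h2 : ((k * Fintype.card V : ℕ) : ℝ) ≤ ((q₀ + 1) * q₀ : ℕ) := by
          exact_mod_cast hq₀'.le
        have h3 : (q₀ : ℝ) + 1 ≤ q := by exact_mod_cast hq.1
        push_cast at h2
        have h4 : ((q₀ : ℝ) + 1) * q₀ ≤ q * (q - 1) :=
          mul_le_mul h3 (by linarith) (Nat.cast_nonneg _) (by linarith)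
        linarith
      have hN8 : (q : ℝ) * (q - 1) / k ≤ 8 * Fintype.card V := by
        rw [div_le_iff₀ hkpos]
        have : (q : ℝ) * (q - 1) ≤ (F + 1 : ℕ) * ((F + 1 : ℕ) - 1) :=
          mul_le_mul hqF (by linarith) (by linarith) (Nat.cast_nonneg _)
        linarith
      refine ⟨?_, fun b K hb hK => LocalPageRank.wp_mainPhase α (by exact_mod_cast hα0) h1 v hε0 hε1
        hn hN hN8 hs₀ hs hFR b K hb hK⟩
      simp only [hψ, if_pos hq]
      exact LocalPageRank.le_expect_mainPhase α hα0 hα1 h1.le v hε0 hε1 hn hN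
    · left
      simp only [hψ, if_neg hq]
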